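/- **Labels.** Let $\mathcal N$ be a set of atomic principals with static delegations (each atomic principal may delegate to arbitrary formulas over $\mathcal N$). Let $\mathbb A$ be the bounded distributive lattice of formulas $a ::= n \mid \top \mid \bot \mid a\wedge a \mid a\vee a$ modulo mutual acts-for, where $\succcurlyeq$ ("acts for") is generated by the lattice rules, distributivity and the delegations ($\varphi\succcurlyeq n$ if $n$ delegates to $\varphi$); $a\wedge b$ is the least authority acting for both. A label (principal) is $\ell=p^{\to}\wedge q^{\leftarrow}$ with $p,q\in\mathbb A$ (confidentiality, integrity); $\mathcal L$ is the set of labels, and $\succcurlyeq,\wedge,\vee$ act componentwise. Projections: $\ell^{\to}=p^{\to}\wedge\bot^{\leftarrow}$, $\ell^{\leftarrow}=\bot^{\to}\wedge q^{\leftarrow}$. Flow order: $p^{\to}\wedge q^{\leftarrow}\sqsubseteq p'^{\to}\wedge q'^{\leftarrow}$ iff $p'\succcurlyeq p$ and $q\succcurlyeq q'$, with join $(p\wedge p')^{\to}\wedge(q\vee q')^{\leftarrow}$. View and voice: $\Delta(p^{\to}\wedge q^{\leftarrow})=q^{\to}$, $\nabla(p^{\to}\wedge q^{\leftarrow})=p^{\leftarrow}$.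 **Calculus (NMIFC).** Types: $\tau::=\mathsf{unit}\mid X\mid\tau+\tau\mid\tau\times\tau\mid\tau\xrightarrow{pc}\tau\mid\forall X[pc].\tau\mid \ell\ \mathsf{says}\ \tau$. Values: $v::=()\mid \mathsf{inj}_i v\mid\langle v,v\rangle\mid\bar\eta_\ell v\mid\lambda(x{:}\tau)[pc].e\mid\Lambda X[pc].e$. Expressions: $e::=x\mid v\mid e\,e\mid e\,\tau\mid\langle e,e\rangle\mid\eta_\ell e\mid\mathsf{proj}_i e\mid\mathsf{inj}_i e\mid\mathsf{bind}\ x=e\ \mathsf{in}\ e\mid\mathsf{case}\ e\ \mathsf{of}\ \mathsf{inj}_1x.e\mid\mathsf{inj}_2x.e\mid\mathsf{decl}\ e\ \mathsf{to}\ \ell\mid\mathsf{endorse}\ e\ \mathsf{to}\ \ell$. Terms are in Church style: $\eta_\ell,\bar\eta_\ell$ carry the type of their content and $\mathsf{inj}_i$ carries the sum type, so a term has at most one type in a given context. Evaluation is call by value, left to right (also under $\eta_\ell$, $\mathsf{inj}_i$, $\mathsf{proj}_i$, in pairs, type applications, scrutinees of $\mathsf{bind}$ and $\mathsf{case}$,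 and arguments of $\mathsf{decl}$ and $\mathsf{endorse}$), on configurations $\langle e,t\rangle$ whose trace $t$ is a finite sequence of events; every step appends one event. The $\beta$-steps for functions, type abstractions, projections, $\mathsf{case}$ and $\mathsf{bind}\ x=\bar\eta_\ell v\ \mathsf{in}\ e\to e[x\mapsto v]$ append the null event $\bullet$; $\eta_\ell v\to\bar\eta_\ell v$ appends $\bar\eta_\ell v$; $\mathsf{decl}\ \bar\eta_{\ell'}v\ \mathsf{to}\ \ell\to\bar\eta_\ell v$ appends $\downarrow^{\to}_{\ell',\ell}v$, and $\mathsf{endorse}\ \bar\eta_{\ell'}v\ \mathsf{to}\ \ell\to\bar\eta_\ell v$ appends $\downarrow^{\leftarrow}_{\ell',\ell}v$. A type protects a label, $\ell\vdash\tau$, if $\tau=\mathsf{unit}$, or $\tau=\ell'\ \mathsf{says}\ \tau'$ with $\ell\sqsubseteq\ell'$, or $\tau=\tau_1\times\tau_2$ with $\ell\vdash\tau_1$, $\ell\vdash\tau_2$. The judgement $\Gamma;pc\vdash e:\tau$ has the usual rules for variables, unit, pairs, projections and injections; bodies of $\lambda,\Lambda$ are typed at the annotated $pc'$; applying a function or type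 abstraction annotated $pc'$ requires $pc\sqsubseteq pc'$ (and a well-formed type argument); $\mathsf{case}$ with result type $\tau$ requires $pc\vdash\tau$; and - $\Gamma;pc\vdash\eta_\ell e:\ell\ \mathsf{says}\ \tau$ if $\Gamma;pc\vdash e:\tau$ and $pc\sqsubseteq\ell$; $\Gamma;pc\vdash\bar\eta_\ell v:\ell\ \mathsf{says}\ \tau$ if $\Gamma;pc\vdash v:\tau$; - $\Gamma;pc\vdash\mathsf{bind}\ x=e\ \mathsf{in}\ e':\tau$ if $\Gamma;pc\vdash e:\ell\ \mathsf{says}\ \tau'$, $\ell\vdash\tau$ and $\Gamma,x{:}\tau';pc\sqcup\ell\vdash e':\tau$; - for $\Gamma;pc\vdash e:\ell'\ \mathsf{says}\ \tau$ and $pc\sqsubseteq\ell$: $\mathsf{decl}\ e\ \mathsf{to}\ \ell$ has type $\ell\ \mathsf{says}\ \tau$ if $\ell'^{\leftarrow}=\ell^{\leftarrow}$ and $\ell'^{\to}\sqsubseteq\ell^{\to}\sqcup\Delta((\ell'\sqcup pc)^{\leftarrow})$; $\mathsf{endorse}\ e\ \mathsf{to}\ \ell$ has it if $\ell'^{\to}=\ell^{\to}$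 and $\ell'^{\leftarrow}\sqsubseteq\ell^{\leftarrow}\sqcup\nabla((\ell'\sqcup pc)^{\to})$. **Attackers.** For $\mathcal A\subseteq\mathcal L$ put $\mathcal A^{\pi}=\{p\mid\exists q\in\mathcal L,\ p^{\pi}\wedge q^{\pi'}\in\mathcal A\}$, $\pi'$ being the aspect opposite to $\pi$. $\mathcal A$ is an attacker if it is closed under $\succcurlyeq$ ($p\in\mathcal A$, $p\succcurlyeq q$ imply $q\in\mathcal A$) and, for both aspects: $a_1,a_2\in\mathcal A^\pi\Rightarrow a_1\wedge a_2\in\mathcal A^\pi$; $a\in\mathcal A^\pi\Rightarrow a\vee b\in\mathcal A^\pi$; $b_1,b_2\notin\mathcal A^\pi\Rightarrow b_1\vee b_2\notin\mathcal A^\pi$; $b\notin\mathcal A^\pi\Rightarrow a\wedge b\notin\mathcal A^\pi$; and $a\in\mathcal A\Rightarrow\nabla(a^{\to})\wedge\Delta(a^{\leftarrow})\in\mathcal A$. (Example: all principals for which $n_1\wedge\dots\wedge n_k$ acts, $k\ge1$, $n_i$ atomic.) Put $\mathcal U=\{\ell\mid\ell^{\leftarrow}\in\mathcal A\}$ (untrusted),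 $\mathcal S=\{\ell\mid\ell^{\to}\notin\mathcal A\}$ (secret), $\mathcal T=\mathcal L\setminus\mathcal U$, $\mathcal P=\mathcal L\setminus\mathcal S$. A type $\tau$ is high for $\mathcal H$ if $h\vdash\tau$ for some $h\in\mathcal H$. **Low equivalence.** For $W\subseteq\mathcal L$, $\approx_W$ on terms is the smallest congruence with $\bar\eta_\ell v\approx_W\bullet_{\ell\,\mathsf{says}\,\tau}$ whenever $\ell\notin W$, where $\tau$ is the content type carried by $\bar\eta_\ell v$ and $\bullet_{\ell\,\mathsf{says}\,\tau}$ is a formal mark for an invisible value of that type. On events it is the smallest congruence containing $\approx_W$ on the values shown, together with $\bar\eta_\ell v\approx_W\bullet$ and $\downarrow^\pi_{\ell',\ell}v\approx_W\bullet$ for $\ell\notin W$. On traces it is the smallest congruence for concatenation that contains $\approx_W$ on events and satisfies $t;\bullet\approx_W t\approx_W\bullet;t$. **Relevant secrets.** Let $\Gamma,x{:}\tau_x,y{:}\tau_y;pc\vdash e:\tau$. Write $e(v,w)\Downarrow t$ if $\langle e[x\mapsto v][y\mapsto w],\,v;w\rangle\to^*\langle u,t\rangle$ for a value $u$. A value $v_1$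 with $\Gamma;pc\vdash v_1:\tau_x$ is *irrelevant* if there are values $v_2,w_1,w_2$ with $\Gamma;pc\vdash v_2:\tau_x$, $\Gamma;pc\vdash w_j:\tau_y$, traces $t^{ij}$ with $e(v_i,w_j)\Downarrow t^{ij}$, and positions $n_{ij}$ in them such that the $n_{ij}$-th event of $t^{ij}$ is not $\approx_{\mathcal T\cap\mathcal P}\bullet$ and, for the prefixes $p^{ij}$ consisting of the first $n_{ij}$ events, all four $p^{ij}$ are $\approx_{\mathcal T\cap\mathcal P}$-equivalent, $p^{11}\approx_{\mathcal T}p^{12}$ and $p^{21}\not\approx_{\mathcal T}p^{22}$. Otherwise it is *relevant*. **Theorem (Transparent endorsement).** Let $\Gamma,x{:}\tau_x,y{:}\tau_y;pc\vdash e:\tau$ and let $e$ contain no $\mathsf{decl}$ expression. Then for every attacker $\mathcal A$ such that $\tau_x$ is high for $\mathcal S$ and $\tau_y$ is high for $\mathcal U$, for all values $v_1,v_2$ of type $\tau_x$ and all values $w_1,w_2$ of type $\tau_y$ that contain no $\mathsf{decl}$ expression (all typed under $\Gamma;pc$), and for all traces with $e(v_i,w_j)\Downarrow t^{ij}$ $(i,j\in\{1,2\})$: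 $$\bigl(v_1\text{ is relevant and }t^{11}\approx_{\mathcal T}t^{12}\bigr)\ \Longrightarrow\ t^{21}\approx_{\mathcal T}t^{22}.$$ -/

import Mathlib

namespace NMIFC

universe u

/-! ## Principals and labels -/

/-- The two security aspects: confidentiality `→` and integrity `←`. -/
inductive Aspect where
  | conf
  | integ

def Aspect.opp : Aspect → Aspect
  | .conf => .integ
  | .integ => .conf

/-- Formulas over the atomic principals `N`. -/
inductive Form (N : Type u) where
  | atom (n : N)
  | top
  | bot
  | conj (p q : Form N)
  | disj (p q : Form N)

/-- A static delegation: `D n φ` says that the atomic principal `n` delegates its authority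
to `φ`, so that `φ` acts for `n`. -/
abbrev Delegation (N : Type u) := N → Form N → Prop

/-- The acts-for relation `p ≽ q` on formulas: the lattice rules (with distributivity, so that
formulas have conjunctive normal forms) together with the static delegations. -/
inductive Form.ActsFor {N : Type u} (D : Delegation N) : Form N → Form N → Prop where
  | bot (p : Form N) : ActsFor D p .bot
  | top (p : Form N) : ActsFor D .top p
  | refl (p : Form N) : ActsFor D p p
  | conjL₁ {p₁ p₂ q : Form N} : ActsFor D p₁ q → ActsFor D (.conj p₁ p₂) q
  | conjL₂ {p₁ p₂ q : Form N} : ActsFor D p₂ q → ActsFor D (.conj p₁ p₂) q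
  | conjR {p q₁ q₂ : Form N} : ActsFor D p q₁ → ActsFor D p q₂ → ActsFor D p (.conj q₁ q₂)
  | disjL {p₁ p₂ q : Form N} : ActsFor D p₁ q → ActsFor D p₂ q → ActsFor D (.disj p₁ p₂) q
  | disjR₁ {p q₁ q₂ : Form N} : ActsFor D p q₁ → ActsFor D p (.disj q₁ q₂)
  | disjR₂ {p q₁ q₂ : Form N} : ActsFor D p q₂ → ActsFor D p (.disj q₁ q₂)
  | trans {p q r : Form N} : ActsFor D p q → ActsFor D q r → ActsFor D p r
  | distrib (p q r : Form N) :
      ActsFor D (.conj (.disj p q) (.disj p r)) (.disj p (.conj q r))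
  | deleg {n : N} {φ : Form N} : D n φ → ActsFor D φ (.atom n)

/-- Formulas that act for each other are identified. -/
def formSetoid {N : Type u} (D : Delegation N) : Setoid (Form N) where
  r p q := Form.ActsFor D p q ∧ Form.ActsFor D q p
  iseqv :=
    { refl := fun p => ⟨.refl p, .refl p⟩
      symm := fun h => ⟨h.2, h.1⟩
      trans := fun h k => ⟨.trans h.1 k.1, .trans k.2 h.2⟩ }

/-- The lattice of authority: formulas modulo mutual acts-for. -/
def Authority {N : Type u} (D : Delegation N) := Quotient (formSetoid D)

namespace Authority
variable {N : Type u} {D : Delegation N}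

def mk (p : Form N) : Authority D := Quotient.mk (formSetoid D) p

def ActsFor (a b : Authority D) : Prop :=
  Quotient.liftOn₂ a b (fun p q => Form.ActsFor D p q) (by
    intro p q p' q' hp hq
    exact propext ⟨fun h => .trans hp.2 (.trans h hq.1), fun h => .trans hp.1 (.trans h hq.2)⟩)

def top : Authority D := mk .top

def bot : Authority D := mk .bot

def conj (a b : Authority D) : Authority D :=
  Quotient.liftOn₂ a b (fun p q => mk (.conj p q)) (by
    intro p q p' q' hp hq
    exact Quotient.sound
      ⟨.conjR (.conjL₁ hp.1) (.conjL₂ hq.1), .conjR (.conjL₁ hp.2) (.conjL₂ hq.2)⟩)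

def disj (a b : Authority D) : Authority D :=
  Quotient.liftOn₂ a b (fun p q => mk (.disj p q)) (by
    intro p q p' q' hp hq
    exact Quotient.sound
      ⟨.disjL (.disjR₁ hp.1) (.disjR₂ hq.1), .disjL (.disjR₁ hp.2) (.disjR₂ hq.2)⟩)

end Authority

/-- A principal or label, in its normal form `p^→ ∧ q^←`: `conf` is `p` and `integ` is `q`. -/
structure Label {N : Type u} (D : Delegation N) where
  conf : Authority D
  integ : Authority D

namespace Label
variable {N : Type u} {D : Delegation N}

def atom (n : N) : Label D := ⟨.mk (.atom n), .mk (.atom n)⟩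

def top : Label D := ⟨.top, .top⟩

def bot : Label D := ⟨.bot, .bot⟩

/-- The projection `ℓ^π`. -/
def proj (π : Aspect) (l : Label D) : Label D :=
  match π with
  | .conf => ⟨l.conf, .bot⟩
  | .integ => ⟨.bot, l.integ⟩

def conj (l m : Label D) : Label D := ⟨l.conf.conj m.conf, l.integ.conj m.integ⟩

def disj (l m : Label D) : Label D := ⟨l.conf.disj m.conf, l.integ.disj m.integ⟩

/-- The join `⊔` of the information flow lattice. -/
def join (l m : Label D) : Label D := ⟨l.conf.conj m.conf, l.integ.disj m.integ⟩

/-- The meet `⊓` of the information flow lattice. -/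
def meet (l m : Label D) : Label D := ⟨l.conf.disj m.conf, l.integ.conj m.integ⟩

/-- The trust ordering `l ≽ m`. -/
def ActsFor (l m : Label D) : Prop := l.conf.ActsFor m.conf ∧ l.integ.ActsFor m.integ

/-- The information flow ordering `l ⊑ m`: more confidentiality and less integrity. -/
def FlowsTo (l m : Label D) : Prop := m.conf.ActsFor l.conf ∧ l.integ.ActsFor m.integ

/-- The view `Δ(p^→ ∧ q^←) = q^→`. -/
def view (l : Label D) : Label D := ⟨l.integ, .bot⟩

/-- The voice `∇(p^→ ∧ q^←) = p^←`. -/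
def voice (l : Label D) : Label D := ⟨.bot, l.conf⟩

end Label

/-! ## Syntax

Variables are de Bruijn indices.  Terms are in Church style: `η` terms carry the type of their
content and injections carry both summands, so that a term has at most one type in a context. -/

/-- A renaming carried under one binder. -/
def upRen (ξ : ℕ → ℕ) : ℕ → ℕ
  | 0 => 0
  | k + 1 => ξ k + 1

/-- Types; `labeled l τ` is the type `l says τ`. -/
inductive Ty {N : Type u} (D : Delegation N) where
  | unit
  | tvar (k : ℕ)
  | sum (τ₁ τ₂ : Ty D)
  | prod (τ₁ τ₂ : Ty D)
  | fn (τ₁ : Ty D) (pc : Label D) (τ₂ : Ty D)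
  | all (pc : Label D) (τ : Ty D)
  | labeled (l : Label D) (τ : Ty D)

namespace Ty
variable {N : Type u} {D : Delegation N}

def rename (ξ : ℕ → ℕ) : Ty D → Ty D
  | unit => unit
  | tvar k => tvar (ξ k)
  | sum τ₁ τ₂ => sum (τ₁.rename ξ) (τ₂.rename ξ)
  | prod τ₁ τ₂ => prod (τ₁.rename ξ) (τ₂.rename ξ)
  | fn τ₁ pc τ₂ => fn (τ₁.rename ξ) pc (τ₂.rename ξ)
  | all pc τ => all pc (τ.rename (upRen ξ))
  | labeled l τ => labeled l (τ.rename ξ)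

/-- Weakening by one type variable. -/
def shift (τ : Ty D) : Ty D := τ.rename Nat.succ

/-- A substitution carried under one type binder. -/
def up (θ : ℕ → Ty D) : ℕ → Ty D
  | 0 => tvar 0
  | k + 1 => (θ k).shift

def subst (θ : ℕ → Ty D) : Ty D → Ty D
  | unit => unit
  | tvar k => θ k
  | sum τ₁ τ₂ => sum (τ₁.subst θ) (τ₂.subst θ)
  | prod τ₁ τ₂ => prod (τ₁.subst θ) (τ₂.subst θ)
  | fn τ₁ pc τ₂ => fn (τ₁.subst θ) pc (τ₂.subst θ)
  | all pc τ => all pc (τ.subst (up θ))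
  | labeled l τ => labeled l (τ.subst θ)

/-- The substitution of `τ` for the innermost type variable. -/
def single (τ : Ty D) : ℕ → Ty D
  | 0 => τ
  | k + 1 => tvar k

/-- All type variables are among the `n` innermost ones. -/
def WF : ℕ → Ty D → Prop
  | _, unit => True
  | n, tvar k => k < n
  | n, sum τ₁ τ₂ => τ₁.WF n ∧ τ₂.WF n
  | n, prod τ₁ τ₂ => τ₁.WF n ∧ τ₂.WF n
  | n, fn τ₁ _ τ₂ => τ₁.WF n ∧ τ₂.WF n
  | n, all _ τ => τ.WF (n + 1)
  | n, labeled _ τ => τ.WF n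

end Ty

/-- Expressions.  `ret l τ e` is the source-level unit term `η_l e` with content of type `τ`, and
`vret l τ v` the run-time value.  An index `i : Bool` stands for `1` (`false`) or `2` (`true`).
`bullet τ` is the mark `•` for an invisible value of type `τ`; it occurs only in low equivalence,
and no well-typed term contains it. -/
inductive Tm {N : Type u} (D : Delegation N) where
  | var (k : ℕ)
  | unit
  | lam (τ : Ty D) (pc : Label D) (e : Tm D)
  | app (e₁ e₂ : Tm D)
  | tlam (pc : Label D) (e : Tm D)
  | tapp (e : Tm D) (τ : Ty D)
  | pair (e₁ e₂ : Tm D)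
  | proj (i : Bool) (e : Tm D)
  | inj (i : Bool) (τ₁ τ₂ : Ty D) (e : Tm D)
  | case (e e₁ e₂ : Tm D)
  | ret (l : Label D) (τ : Ty D) (e : Tm D)
  | vret (l : Label D) (τ : Ty D) (v : Tm D)
  | bind (e e' : Tm D)
  | decl (e : Tm D) (l : Label D)
  | endorse (e : Tm D) (l : Label D)
  | bullet (τ : Ty D)

namespace Tm
variable {N : Type u} {D : Delegation N}

inductive IsValue : Tm D → Prop where
  | unit : IsValue unit
  | inj {i : Bool} {τ₁ τ₂ : Ty D} {v : Tm D} : IsValue v → IsValue (inj i τ₁ τ₂ v)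
  | pair {v₁ v₂ : Tm D} : IsValue v₁ → IsValue v₂ → IsValue (pair v₁ v₂)
  | vret {l : Label D} {τ : Ty D} {v : Tm D} : IsValue v → IsValue (vret l τ v)
  | lam {τ : Ty D} {pc : Label D} {e : Tm D} : IsValue (lam τ pc e)
  | tlam {pc : Label D} {e : Tm D} : IsValue (tlam pc e)

/-- The expression contains no `decl` expression. -/
def DeclFree : Tm D → Prop
  | var _ => True
  | unit => True
  | lam _ _ e => e.DeclFree
  | app e₁ e₂ => e₁.DeclFree ∧ e₂.DeclFree
  | tlam _ e => e.DeclFree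
  | tapp e _ => e.DeclFree
  | pair e₁ e₂ => e₁.DeclFree ∧ e₂.DeclFree
  | proj _ e => e.DeclFree
  | inj _ _ _ e => e.DeclFree
  | case e e₁ e₂ => e.DeclFree ∧ e₁.DeclFree ∧ e₂.DeclFree
  | ret _ _ e => e.DeclFree
  | vret _ _ v => v.DeclFree
  | bind e e' => e.DeclFree ∧ e'.DeclFree
  | decl _ _ => False
  | endorse e _ => e.DeclFree
  | bullet _ => True

/-- Substitution of types for type variables. -/
def tsubst (θ : ℕ → Ty D) : Tm D → Tm D
  | var k => var k
  | unit => unit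
  | lam τ pc e => lam (τ.subst θ) pc (e.tsubst θ)
  | app e₁ e₂ => app (e₁.tsubst θ) (e₂.tsubst θ)
  | tlam pc e => tlam pc (e.tsubst (Ty.up θ))
  | tapp e τ => tapp (e.tsubst θ) (τ.subst θ)
  | pair e₁ e₂ => pair (e₁.tsubst θ) (e₂.tsubst θ)
  | proj i e => proj i (e.tsubst θ)
  | inj i τ₁ τ₂ e => inj i (τ₁.subst θ) (τ₂.subst θ) (e.tsubst θ)
  | case e e₁ e₂ => case (e.tsubst θ) (e₁.tsubst θ) (e₂.tsubst θ)
  | ret l τ e => ret l (τ.subst θ) (e.tsubst θ)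
  | vret l τ v => vret l (τ.subst θ) (v.tsubst θ)
  | bind e e' => bind (e.tsubst θ) (e'.tsubst θ)
  | decl e l => decl (e.tsubst θ) l
  | endorse e l => endorse (e.tsubst θ) l
  | bullet τ => bullet (τ.subst θ)

/-- Renaming of term variables. -/
def rename (ξ : ℕ → ℕ) : Tm D → Tm D
  | var k => var (ξ k)
  | unit => unit
  | lam τ pc e => lam τ pc (e.rename (upRen ξ))
  | app e₁ e₂ => app (e₁.rename ξ) (e₂.rename ξ)
  | tlam pc e => tlam pc (e.rename ξ)
  | tapp e τ => tapp (e.rename ξ) τ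
  | pair e₁ e₂ => pair (e₁.rename ξ) (e₂.rename ξ)
  | proj i e => proj i (e.rename ξ)
  | inj i τ₁ τ₂ e => inj i τ₁ τ₂ (e.rename ξ)
  | case e e₁ e₂ => case (e.rename ξ) (e₁.rename (upRen ξ)) (e₂.rename (upRen ξ))
  | ret l τ e => ret l τ (e.rename ξ)
  | vret l τ v => vret l τ (v.rename ξ)
  | bind e e' => bind (e.rename ξ) (e'.rename (upRen ξ))
  | decl e l => decl (e.rename ξ) l
  | endorse e l => endorse (e.rename ξ) l
  | bullet τ => bullet τ

/-- A substitution carried under one term binder. -/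
def up (σ : ℕ → Tm D) : ℕ → Tm D
  | 0 => var 0
  | k + 1 => (σ k).rename Nat.succ

/-- Capture-avoiding substitution of terms for term variables. -/
def subst (σ : ℕ → Tm D) : Tm D → Tm D
  | var k => σ k
  | unit => unit
  | lam τ pc e => lam τ pc (e.subst (up σ))
  | app e₁ e₂ => app (e₁.subst σ) (e₂.subst σ)
  | tlam pc e => tlam pc (e.subst (fun k => (σ k).tsubst (fun j => .tvar (j + 1))))
  | tapp e τ => tapp (e.subst σ) τ
  | pair e₁ e₂ => pair (e₁.subst σ) (e₂.subst σ)
  | proj i e => proj i (e.subst σ)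
  | inj i τ₁ τ₂ e => inj i τ₁ τ₂ (e.subst σ)
  | case e e₁ e₂ => case (e.subst σ) (e₁.subst (up σ)) (e₂.subst (up σ))
  | ret l τ e => ret l τ (e.subst σ)
  | vret l τ v => vret l τ (v.subst σ)
  | bind e e' => bind (e.subst σ) (e'.subst (up σ))
  | decl e l => decl (e.subst σ) l
  | endorse e l => endorse (e.subst σ) l
  | bullet τ => bullet τ

/-- `e[x ↦ v]` for the innermost variable `x`. -/
def inst (e v : Tm D) : Tm D :=
  e.subst (fun k => match k with
    | 0 => v
    | j + 1 => var j)

/-- `e[x ↦ v][y ↦ w]` for the two innermost variables, in a context `Γ, x, y`;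
here `v` and `w` live in `Γ`. -/
def inst₂ (e v w : Tm D) : Tm D :=
  e.subst (fun k => match k with
    | 0 => w
    | 1 => v
    | j + 2 => var j)

end Tm

/-! ## Operational semantics -/

/-- Trace events: no event, a protected value (or an input value), or a downgrade of aspect `π`
of the value `v : τ` from the label `l'` to the label `l`. -/
inductive Event {N : Type u} (D : Delegation N) where
  | bullet
  | val (v : Tm D)
  | down (π : Aspect) (l' l : Label D) (τ : Ty D) (v : Tm D)

/-- Traces form the free monoid over events. -/
abbrev Trace {N : Type u} (D : Delegation N) := List (Event D)

section Semantics
variable {N : Type u} {D : Delegation N}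

inductive Red : Tm D → Tm D → Prop where
  | app {τ : Ty D} {pc : Label D} {e v : Tm D} : v.IsValue →
      Red (.app (.lam τ pc e) v) (e.inst v)
  | tapp {pc : Label D} {e : Tm D} {τ : Ty D} :
      Red (.tapp (.tlam pc e) τ) (e.tsubst (Ty.single τ))
  | proj {i : Bool} {v₁ v₂ : Tm D} : v₁.IsValue → v₂.IsValue →
      Red (.proj i (.pair v₁ v₂)) (bif i then v₂ else v₁)
  | case {i : Bool} {τ₁ τ₂ : Ty D} {v e₁ e₂ : Tm D} : v.IsValue →
      Red (.case (.inj i τ₁ τ₂ v) e₁ e₂) ((bif i then e₂ else e₁).inst v)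
  | bind {l : Label D} {τ : Ty D} {v e : Tm D} : v.IsValue →
      Red (.bind (.vret l τ v) e) (e.inst v)

/-- Evaluation contexts. -/
inductive ECtx (D : Delegation N) where
  | hole
  | appL (E : ECtx D) (e : Tm D)
  | appR (v : Tm D) (hv : v.IsValue) (E : ECtx D)
  | tapp (E : ECtx D) (τ : Ty D)
  | pairL (E : ECtx D) (e : Tm D)
  | pairR (v : Tm D) (hv : v.IsValue) (E : ECtx D)
  | ret (l : Label D) (τ : Ty D) (E : ECtx D)
  | proj (i : Bool) (E : ECtx D)
  | inj (i : Bool) (τ₁ τ₂ : Ty D) (E : ECtx D)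
  | bind (E : ECtx D) (e : Tm D)
  | case (E : ECtx D) (e₁ e₂ : Tm D)
  | decl (E : ECtx D) (l : Label D)
  | endorse (E : ECtx D) (l : Label D)

def ECtx.fill : ECtx D → Tm D → Tm D
  | hole, a => a
  | appL E e, a => .app (E.fill a) e
  | appR v _ E, a => .app v (E.fill a)
  | tapp E τ, a => .tapp (E.fill a) τ
  | pairL E e, a => .pair (E.fill a) e
  | pairR v _ E, a => .pair v (E.fill a)
  | ret l τ E, a => .ret l τ (E.fill a)
  | proj i E, a => .proj i (E.fill a)
  | inj i τ₁ τ₂ E, a => .inj i τ₁ τ₂ (E.fill a)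
  | bind E e, a => .bind (E.fill a) e
  | case E e₁ e₂, a => .case (E.fill a) e₁ e₂
  | decl E l, a => .decl (E.fill a) l
  | endorse E l, a => .endorse (E.fill a) l

/-- One step `⟨e, t⟩ ⟶ ⟨e', t'⟩`. -/
inductive Step : Tm D × Trace D → Tm D × Trace D → Prop where
  | red {e e' : Tm D} {t : Trace D} : Red e e' → Step (e, t) (e', t ++ [.bullet])
  | unitM {l : Label D} {τ : Ty D} {v : Tm D} {t : Trace D} : v.IsValue →
      Step (.ret l τ v, t) (.vret l τ v, t ++ [.val (.vret l τ v)])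
  | decl {l' l : Label D} {τ : Ty D} {v : Tm D} {t : Trace D} : v.IsValue →
      Step (.decl (.vret l' τ v) l, t) (.vret l τ v, t ++ [.down .conf l' l τ v])
  | endorse {l' l : Label D} {τ : Ty D} {v : Tm D} {t : Trace D} : v.IsValue →
      Step (.endorse (.vret l' τ v) l, t) (.vret l τ v, t ++ [.down .integ l' l τ v])
  | eval {e e' : Tm D} {t t' : Trace D} (E : ECtx D) : Step (e, t) (e', t') →
      Step (E.fill e, t) (E.fill e', t')

/-- `⟨e[x ↦ v][y ↦ w], v; w⟩ ⟶* ⟨u, t⟩` for some value `u`. -/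
def Runs (e v w : Tm D) (t : Trace D) : Prop :=
  ∃ u : Tm D, u.IsValue ∧
    Relation.ReflTransGen Step (e.inst₂ v w, [.val v, .val w]) (u, t)

/-! ## Type system -/

/-- The type `τ` protects the label `l`. -/
inductive Protects : Label D → Ty D → Prop where
  | unit (l : Label D) : Protects l .unit
  | lbl {l' l : Label D} {τ : Ty D} : l'.FlowsTo l → Protects l' (.labeled l τ)
  | pair {l : Label D} {τ₁ τ₂ : Ty D} : Protects l τ₁ → Protects l τ₂ →
      Protects l (.prod τ₁ τ₂)

/-- The typing judgement `Γ; pc ⊢ e : τ`; the context consists of `n` type variables and of the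
list `Γ` of the types of the term variables, the innermost first. -/
inductive HasType : ℕ → List (Ty D) → Label D → Tm D → Ty D → Prop where
  | var {n : ℕ} {Γ : List (Ty D)} {pc : Label D} {k : ℕ} {τ : Ty D} :
      Γ[k]? = some τ → HasType n Γ pc (.var k) τ
  | unit {n : ℕ} {Γ : List (Ty D)} {pc : Label D} : HasType n Γ pc .unit .unit
  | lam {n : ℕ} {Γ : List (Ty D)} {pc pc' : Label D} {τ₁ τ₂ : Ty D} {e : Tm D} :
      HasType n (τ₁ :: Γ) pc' e τ₂ → HasType n Γ pc (.lam τ₁ pc' e) (.fn τ₁ pc' τ₂)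
  | app {n : ℕ} {Γ : List (Ty D)} {pc pc' : Label D} {τ' τ : Ty D} {e₁ e₂ : Tm D} :
      HasType n Γ pc e₁ (.fn τ' pc' τ) → HasType n Γ pc e₂ τ' → pc.FlowsTo pc' →
      HasType n Γ pc (.app e₁ e₂) τ
  | tlam {n : ℕ} {Γ : List (Ty D)} {pc pc' : Label D} {τ : Ty D} {e : Tm D} :
      HasType (n + 1) (Γ.map Ty.shift) pc' e τ → HasType n Γ pc (.tlam pc' e) (.all pc' τ)
  | tapp {n : ℕ} {Γ : List (Ty D)} {pc pc' : Label D} {τ τ' : Ty D} {e : Tm D} :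
      HasType n Γ pc e (.all pc' τ) → pc.FlowsTo pc' → τ'.WF n →
      HasType n Γ pc (.tapp e τ') (τ.subst (Ty.single τ'))
  | pair {n : ℕ} {Γ : List (Ty D)} {pc : Label D} {τ₁ τ₂ : Ty D} {e₁ e₂ : Tm D} :
      HasType n Γ pc e₁ τ₁ → HasType n Γ pc e₂ τ₂ →
      HasType n Γ pc (.pair e₁ e₂) (.prod τ₁ τ₂)
  | proj {n : ℕ} {Γ : List (Ty D)} {pc : Label D} {i : Bool} {τ₁ τ₂ : Ty D} {e : Tm D} :
      HasType n Γ pc e (.prod τ₁ τ₂) → HasType n Γ pc (.proj i e) (bif i then τ₂ else τ₁)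
  | inj {n : ℕ} {Γ : List (Ty D)} {pc : Label D} {i : Bool} {τ₁ τ₂ : Ty D} {e : Tm D} :
      HasType n Γ pc e (bif i then τ₂ else τ₁) →
      HasType n Γ pc (.inj i τ₁ τ₂ e) (.sum τ₁ τ₂)
  | case {n : ℕ} {Γ : List (Ty D)} {pc : Label D} {τ₁ τ₂ τ : Ty D} {e e₁ e₂ : Tm D} :
      HasType n Γ pc e (.sum τ₁ τ₂) → Protects pc τ →
      HasType n (τ₁ :: Γ) pc e₁ τ → HasType n (τ₂ :: Γ) pc e₂ τ →
      HasType n Γ pc (.case e e₁ e₂) τ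
  | unitM {n : ℕ} {Γ : List (Ty D)} {pc l : Label D} {τ : Ty D} {e : Tm D} :
      HasType n Γ pc e τ → pc.FlowsTo l → HasType n Γ pc (.ret l τ e) (.labeled l τ)
  | vunitM {n : ℕ} {Γ : List (Ty D)} {pc l : Label D} {τ : Ty D} {v : Tm D} :
      v.IsValue → HasType n Γ pc v τ → HasType n Γ pc (.vret l τ v) (.labeled l τ)
  | bindM {n : ℕ} {Γ : List (Ty D)} {pc l : Label D} {τ' τ : Ty D} {e e' : Tm D} :
      HasType n Γ pc e (.labeled l τ') → Protects l τ →
      HasType n (τ' :: Γ) (pc.join l) e' τ → HasType n Γ pc (.bind e e') τ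
  | decl {n : ℕ} {Γ : List (Ty D)} {pc l' l : Label D} {τ : Ty D} {e : Tm D} :
      HasType n Γ pc e (.labeled l' τ) → l'.proj .integ = l.proj .integ → pc.FlowsTo l →
      (l'.proj .conf).FlowsTo ((l.proj .conf).join ((l'.join pc).proj .integ).view) →
      HasType n Γ pc (.decl e l) (.labeled l τ)
  | endorse {n : ℕ} {Γ : List (Ty D)} {pc l' l : Label D} {τ : Ty D} {e : Tm D} :
      HasType n Γ pc e (.labeled l' τ) → l'.proj .conf = l.proj .conf → pc.FlowsTo l →
      (l'.proj .integ).FlowsTo ((l.proj .integ).join ((l'.join pc).proj .conf).voice) →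
      HasType n Γ pc (.endorse e l) (.labeled l τ)

/-! ## Attackers -/

/-- `𝒜^π`: the principals whose aspect `π` the attacker has. -/
def aspectOf (A : Set (Label D)) (π : Aspect) : Set (Label D) :=
  {p | ∃ q : Label D, (p.proj π).conj (q.proj π.opp) ∈ A}

/-- Attackers, as sets of principals. -/
structure IsAttacker (A : Set (Label D)) : Prop where
  /-- An attacker that has a principal has every principal that it acts for. -/
  closed : ∀ p ∈ A, ∀ q : Label D, p.ActsFor q → q ∈ A
  /-- Attacking principals may collude. -/
  conj_mem : ∀ π, ∀ a₁ ∈ aspectOf A π, ∀ a₂ ∈ aspectOf A π, a₁.conj a₂ ∈ aspectOf A π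
  /-- Attackers may attenuate their power. -/
  disj_mem : ∀ π, ∀ a ∈ aspectOf A π, ∀ b : Label D, a.disj b ∈ aspectOf A π
  disj_not_mem : ∀ π, ∀ b₁ ∉ aspectOf A π, ∀ b₂ ∉ aspectOf A π, b₁.disj b₂ ∉ aspectOf A π
  conj_not_mem : ∀ π, ∀ a : Label D, ∀ b ∉ aspectOf A π, a.conj b ∉ aspectOf A π
  /-- Attackers have the same power in confidentiality and integrity. -/
  voice_view : ∀ a ∈ A, (a.proj .conf).voice.conj (a.proj .integ).view ∈ A

/-- The untrusted high set induced by an attacker. -/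
def untrusted (A : Set (Label D)) : Set (Label D) := {l | l.proj .integ ∈ A}

/-- The secret high set induced by an attacker. -/
def secret (A : Set (Label D)) : Set (Label D) := {l | l.proj .conf ∉ A}

def trusted (A : Set (Label D)) : Set (Label D) := (untrusted A)ᶜ

/-- The labels that are both trusted and public. -/
def lowSet (A : Set (Label D)) : Set (Label D) := (untrusted A)ᶜ ∩ (secret A)ᶜ

/-- `τ` is a high type for the high set `H`. -/
def HighType (H : Set (Label D)) (τ : Ty D) : Prop := ∃ h ∈ H, Protects h τ

/-! ## Low equivalence -/

/-- Low equivalence: the smallest congruence that identifies every value `η_l v` with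
`l` outside `Lo` with the mark `•` of its type. -/
inductive Equiv (Lo : Set (Label D)) : Tm D → Tm D → Prop where
  | hide {l : Label D} {τ : Ty D} {v : Tm D} : l ∉ Lo →
      Equiv Lo (.vret l τ v) (.bullet (.labeled l τ))
  | refl (e : Tm D) : Equiv Lo e e
  | symm {e e' : Tm D} : Equiv Lo e e' → Equiv Lo e' e
  | trans {e e' e'' : Tm D} : Equiv Lo e e' → Equiv Lo e' e'' → Equiv Lo e e''
  | lam {τ : Ty D} {pc : Label D} {e e' : Tm D} : Equiv Lo e e' →
      Equiv Lo (.lam τ pc e) (.lam τ pc e')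
  | app {e₁ e₁' e₂ e₂' : Tm D} : Equiv Lo e₁ e₁' → Equiv Lo e₂ e₂' →
      Equiv Lo (.app e₁ e₂) (.app e₁' e₂')
  | tlam {pc : Label D} {e e' : Tm D} : Equiv Lo e e' → Equiv Lo (.tlam pc e) (.tlam pc e')
  | tapp {τ : Ty D} {e e' : Tm D} : Equiv Lo e e' → Equiv Lo (.tapp e τ) (.tapp e' τ)
  | pair {e₁ e₁' e₂ e₂' : Tm D} : Equiv Lo e₁ e₁' → Equiv Lo e₂ e₂' →
      Equiv Lo (.pair e₁ e₂) (.pair e₁' e₂')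
  | proj {i : Bool} {e e' : Tm D} : Equiv Lo e e' → Equiv Lo (.proj i e) (.proj i e')
  | inj {i : Bool} {τ₁ τ₂ : Ty D} {e e' : Tm D} : Equiv Lo e e' →
      Equiv Lo (.inj i τ₁ τ₂ e) (.inj i τ₁ τ₂ e')
  | case {e e' e₁ e₁' e₂ e₂' : Tm D} : Equiv Lo e e' → Equiv Lo e₁ e₁' → Equiv Lo e₂ e₂' →
      Equiv Lo (.case e e₁ e₂) (.case e' e₁' e₂')
  | ret {l : Label D} {τ : Ty D} {e e' : Tm D} : Equiv Lo e e' →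
      Equiv Lo (.ret l τ e) (.ret l τ e')
  | vret {l : Label D} {τ : Ty D} {v v' : Tm D} : Equiv Lo v v' →
      Equiv Lo (.vret l τ v) (.vret l τ v')
  | bind {e₁ e₁' e₂ e₂' : Tm D} : Equiv Lo e₁ e₁' → Equiv Lo e₂ e₂' →
      Equiv Lo (.bind e₁ e₂) (.bind e₁' e₂')
  | decl {l : Label D} {e e' : Tm D} : Equiv Lo e e' → Equiv Lo (.decl e l) (.decl e' l)
  | endorse {l : Label D} {e e' : Tm D} : Equiv Lo e e' →
      Equiv Lo (.endorse e l) (.endorse e' l)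

/-- Low equivalence of events. -/
inductive EventEquiv (Lo : Set (Label D)) : Event D → Event D → Prop where
  | hideVal {l : Label D} {τ : Ty D} {v : Tm D} : l ∉ Lo →
      EventEquiv Lo (.val (.vret l τ v)) .bullet
  | hideDown {π : Aspect} {l' l : Label D} {τ : Ty D} {v : Tm D} : l ∉ Lo →
      EventEquiv Lo (.down π l' l τ v) .bullet
  | refl (c : Event D) : EventEquiv Lo c c
  | symm {c c' : Event D} : EventEquiv Lo c c' → EventEquiv Lo c' c
  | trans {c c' c'' : Event D} : EventEquiv Lo c c' → EventEquiv Lo c' c'' → EventEquiv Lo c c''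
  | val {v v' : Tm D} : Equiv Lo v v' → EventEquiv Lo (.val v) (.val v')
  | down {π : Aspect} {l' l : Label D} {τ : Ty D} {v v' : Tm D} : Equiv Lo v v' →
      EventEquiv Lo (.down π l' l τ v) (.down π l' l τ v')

/-- Low equivalence of traces. -/
inductive TraceEquiv (Lo : Set (Label D)) : Trace D → Trace D → Prop where
  | lift {c c' : Event D} : EventEquiv Lo c c' → TraceEquiv Lo [c] [c']
  | bulletR (t : Trace D) : TraceEquiv Lo (t ++ [.bullet]) t
  | bulletL (t : Trace D) : TraceEquiv Lo (.bullet :: t) t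
  | refl (t : Trace D) : TraceEquiv Lo t t
  | symm {t t' : Trace D} : TraceEquiv Lo t t' → TraceEquiv Lo t' t
  | trans {t t' t'' : Trace D} : TraceEquiv Lo t t' → TraceEquiv Lo t' t'' → TraceEquiv Lo t t''
  | append {t₁ t₁' t₂ t₂' : Trace D} : TraceEquiv Lo t₁ t₁' → TraceEquiv Lo t₂ t₂' →
      TraceEquiv Lo (t₁ ++ t₂) (t₁' ++ t₂')

/-! ## Transparent endorsement -/

/-- `v` is a value with `Γ; pc ⊢ v : τ`. -/
def IsInput (n : ℕ) (Γ : List (Ty D)) (pc : Label D) (τ : Ty D) (v : Tm D) : Prop :=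
  v.IsValue ∧ HasType n Γ pc v τ

/-- `v₁` is an irrelevant secret input (an irrelevant `→`-input) of `e` with respect to `A`.
The trace index `k i j` counts from zero, so the prefix that ends in that element
is `(t i j).take (k i j + 1)`. -/
def IrrelevantSecret (A : Set (Label D)) (n : ℕ) (Γ : List (Ty D)) (pc : Label D)
    (τx τy : Ty D) (e v₁ : Tm D) : Prop :=
  IsInput n Γ pc τx v₁ ∧
  ∃ (v w : Fin 2 → Tm D) (t : Fin 2 → Fin 2 → Trace D) (k : Fin 2 → Fin 2 → ℕ),
    v 0 = v₁ ∧ IsInput n Γ pc τx (v 1) ∧ (∀ j, IsInput n Γ pc τy (w j)) ∧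
    (∀ i j, Runs e (v i) (w j) (t i j)) ∧
    (∀ i j, ∃ c, (t i j)[k i j]? = some c ∧ ¬ EventEquiv (lowSet A) c .bullet) ∧
    (∀ i j i' j', TraceEquiv (lowSet A)
      ((t i j).take (k i j + 1)) ((t i' j').take (k i' j' + 1))) ∧
    TraceEquiv (trusted A) ((t 0 0).take (k 0 0 + 1)) ((t 0 1).take (k 0 1 + 1)) ∧
    ¬ TraceEquiv (trusted A) ((t 1 0).take (k 1 0 + 1)) ((t 1 1).take (k 1 1 + 1))

def RelevantSecret (A : Set (Label D)) (n : ℕ) (Γ : List (Ty D)) (pc : Label D)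
    (τx τy : Ty D) (e v₁ : Tm D) : Prop :=
  ¬ IrrelevantSecret A n Γ pc τx τy e v₁

/-- The program `e`, with a secret input `x : τx` and an untrusted input `y : τy`, transparently
endorses.  The attacks `w 0` and `w 1` perform no declassification of their own. -/
def TransparentlyEndorses (n : ℕ) (Γ : List (Ty D)) (pc : Label D)
    (τx τy : Ty D) (e : Tm D) : Prop :=
  ∀ A : Set (Label D), IsAttacker A →
    HighType (secret A) τx → HighType (untrusted A) τy →
    ∀ (v w : Fin 2 → Tm D) (t : Fin 2 → Fin 2 → Trace D),
      (∀ i, IsInput n Γ pc τx (v i)) →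
      (∀ j, IsInput n Γ pc τy (w j) ∧ (w j).DeclFree) →
      (∀ i j, Runs e (v i) (w j) (t i j)) →
      RelevantSecret A n Γ pc τx τy e (v 0) ∧ TraceEquiv (trusted A) (t 0 0) (t 0 1) →
      TraceEquiv (trusted A) (t 1 0) (t 1 1)

end Semantics

end NMIFC

/-!
Erasing from terms and events whatever is invisible to an observer turns low equivalence into
equality.  Two runs of well-typed expressions with the same erasure then proceed in lockstep until
a downgrade moves different contents from an invisible label to a visible one: code that depends on
an invisible value runs at an invisible program counter, where it emits no visible event.

For the public observer such a downgrade does not exist.  An endorsement preserves confidentiality,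
and a declassification would have to come from inside a secret input, where it is confined.  So
replacing one secret input by another does not change the public part of a run.

For the trusted observer such a downgrade can only be an endorsement, and the restriction to the
voice of the source makes its target public.  If the second pair of runs differs for the trusted
observer, then the differing endorsement is thus a low event of both runs.  It has a counterpart in
the first pair of runs, which agree on everything trusted, and stopping all four runs there shows
that the first secret is irrelevant.
-/

namespace NMIFC

variable {N : Type*} {D : Delegation N}

/-! ## Type substitution -/

theorem upRen_comp (ζ ξ : ℕ → ℕ) : upRen (ζ ∘ ξ) = upRen ζ ∘ upRen ξ := by
  funext k
  cases k <;> rfl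

namespace Ty

theorem rename_rename (τ : Ty D) (ξ ζ : ℕ → ℕ) :
    (τ.rename ξ).rename ζ = τ.rename (ζ ∘ ξ) := by
  induction τ generalizing ξ ζ <;> simp_all [rename, upRen_comp]

theorem up_comp_upRen (θ : ℕ → Ty D) (ξ : ℕ → ℕ) : up (θ ∘ ξ) = up θ ∘ upRen ξ := by
  funext k
  cases k <;> rfl

theorem rename_subst (τ : Ty D) (ξ : ℕ → ℕ) (θ : ℕ → Ty D) :
    (τ.rename ξ).subst θ = τ.subst (θ ∘ ξ) := by
  induction τ generalizing ξ θ <;> simp_all [rename, subst, up_comp_upRen]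

theorem up_rename_comp (ξ : ℕ → ℕ) (θ : ℕ → Ty D) :
    up (rename ξ ∘ θ) = rename (upRen ξ) ∘ up θ := by
  funext k
  cases k with
  | zero => rfl
  | succ k => exact (rename_rename ..).trans (rename_rename (θ k) Nat.succ (upRen ξ)).symm

theorem subst_rename (τ : Ty D) (θ : ℕ → Ty D) (ξ : ℕ → ℕ) :
    (τ.subst θ).rename ξ = τ.subst (rename ξ ∘ θ) := by
  induction τ generalizing ξ θ <;> simp_all [rename, subst, up_rename_comp]

theorem shift_subst_up (τ : Ty D) (θ : ℕ → Ty D) :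
    τ.shift.subst (up θ) = (τ.subst θ).shift :=
  (rename_subst ..).trans (subst_rename ..).symm

theorem up_subst_comp (ζ θ : ℕ → Ty D) : up (subst ζ ∘ θ) = subst (up ζ) ∘ up θ := by
  funext k
  cases k with
  | zero => rfl
  | succ k => exact (shift_subst_up ..).symm

theorem subst_subst (τ : Ty D) (θ ζ : ℕ → Ty D) :
    (τ.subst θ).subst ζ = τ.subst (subst ζ ∘ θ) := by
  induction τ generalizing ζ θ <;> simp_all [subst, up_subst_comp]

theorem up_tvar : up (tvar : ℕ → Ty D) = tvar := by
  funext k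
  cases k <;> rfl

theorem subst_tvar (τ : Ty D) : τ.subst tvar = τ := by
  induction τ <;> simp_all [subst, up_tvar]

theorem shift_eq_subst (τ : Ty D) : τ.shift = τ.subst fun k => tvar (k + 1) := by
  conv_lhs => rw [← subst_tvar τ]
  exact subst_rename ..

theorem shift_subst_single (τ τ' : Ty D) : τ.shift.subst (single τ') = τ :=
  (rename_subst ..).trans (subst_tvar τ)

theorem subst_single_subst (τ τ' : Ty D) (θ : ℕ → Ty D) :
    (τ.subst (single τ')).subst θ = (τ.subst (up θ)).subst (single (τ'.subst θ)) := by
  rw [subst_subst, subst_subst]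
  congr 1
  funext k
  cases k with
  | zero => rfl
  | succ k => exact (shift_subst_single _ _).symm

theorem WF.rename {τ : Ty D} {n m : ℕ} {ξ : ℕ → ℕ} (h : τ.WF n) (hξ : ∀ k < n, ξ k < m) :
    (τ.rename ξ).WF m := by
  induction τ generalizing n m ξ with
  | all pc τ ih =>
    refine ih (n := n + 1) h fun k hk => ?_
    cases k with
    | zero => exact m.succ_pos
    | succ k => exact Nat.succ_lt_succ (hξ k (Nat.lt_of_succ_lt_succ hk))
  | tvar k => exact hξ k h
  | unit => trivial
  | labeled l τ ih => exact ih h hξ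
  | sum _ _ ih₁ ih₂ | prod _ _ ih₁ ih₂ | fn _ _ _ ih₁ ih₂ => exact ⟨ih₁ h.1 hξ, ih₂ h.2 hξ⟩

theorem WF.up {θ : ℕ → Ty D} {n m : ℕ} (hθ : ∀ k < n, (θ k).WF m) :
    ∀ k < n + 1, (Ty.up θ k).WF (m + 1)
  | 0, _ => m.succ_pos
  | k + 1, hk => (hθ k (Nat.lt_of_succ_lt_succ hk)).rename fun _ => Nat.succ_lt_succ

theorem WF.subst {τ : Ty D} {n m : ℕ} {θ : ℕ → Ty D} (h : τ.WF n)
    (hθ : ∀ k < n, (θ k).WF m) : (τ.subst θ).WF m := by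
  induction τ generalizing n m θ with
  | all pc τ ih => exact ih (n := n + 1) h (WF.up hθ)
  | tvar k => exact hθ k h
  | unit => trivial
  | labeled l τ ih => exact ih h hθ
  | sum _ _ ih₁ ih₂ | prod _ _ ih₁ ih₂ | fn _ _ _ ih₁ ih₂ => exact ⟨ih₁ h.1 hθ, ih₂ h.2 hθ⟩

end Ty

/-! ## Typing under substitution -/

namespace Tm

theorem IsValue.rename {v : Tm D} (h : v.IsValue) (ξ : ℕ → ℕ) : (v.rename ξ).IsValue := by
  induction h <;> constructor <;> assumption

theorem IsValue.tsubst {v : Tm D} (h : v.IsValue) (θ : ℕ → Ty D) : (v.tsubst θ).IsValue := by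
  induction h <;> constructor <;> assumption

theorem IsValue.subst {v : Tm D} (h : v.IsValue) (σ : ℕ → Tm D) : (v.subst σ).IsValue := by
  induction h <;> constructor <;> assumption

end Tm

theorem Protects.subst {l : Label D} {τ : Ty D} (h : Protects l τ) (θ : ℕ → Ty D) :
    Protects l (τ.subst θ) := by
  induction h with
  | unit => exact .unit _
  | lbl h => exact .lbl h
  | pair _ _ ih₁ ih₂ => exact .pair ih₁ ih₂

namespace HasType

theorem value_pc {n : ℕ} {Γ : List (Ty D)} {pc : Label D} {v : Tm D} {τ : Ty D}
    (h : HasType n Γ pc v τ) (hv : v.IsValue) (pc' : Label D) : HasType n Γ pc' v τ := by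
  induction hv generalizing τ with
  | unit => cases h; exact .unit
  | inj _ ih => cases h with | inj h => exact .inj (ih h)
  | pair _ _ ih₁ ih₂ => cases h with | pair h₁ h₂ => exact .pair (ih₁ h₁) (ih₂ h₂)
  | vret hv ih => cases h with | vunitM _ h => exact .vunitM hv (ih h)
  | lam => cases h with | lam h => exact .lam h
  | tlam => cases h with | tlam h => exact .tlam h

theorem tsubst {n m : ℕ} {Γ : List (Ty D)} {pc : Label D} {e : Tm D} {τ : Ty D} {θ : ℕ → Ty D}
    (h : HasType n Γ pc e τ) (hθ : ∀ k < n, (θ k).WF m) :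
    HasType m (Γ.map (Ty.subst θ)) pc (e.tsubst θ) (τ.subst θ) := by
  induction h generalizing m θ with
  | var h => exact .var (by rw [List.getElem?_map, h, Option.map_some])
  | unit => exact .unit
  | lam _ ih => exact .lam (ih hθ)
  | app _ _ hf ih₁ ih₂ => exact .app (ih₁ hθ) (ih₂ hθ) hf
  | tlam _ ih =>
    refine .tlam ?_
    simpa only [List.map_map, Function.comp_def, Ty.shift_subst_up] using ih (Ty.WF.up hθ)
  | tapp _ hf hw ih =>
    rw [Ty.subst_single_subst]
    exact .tapp (ih hθ) hf (hw.subst hθ)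
  | pair _ _ ih₁ ih₂ => exact .pair (ih₁ hθ) (ih₂ hθ)
  | proj _ ih => exact Bool.apply_cond (Ty.subst θ) ▸ .proj (ih hθ)
  | inj _ ih => exact .inj (Bool.apply_cond (Ty.subst θ) ▸ ih hθ)
  | case _ hp _ _ ih ih₁ ih₂ => exact .case (ih hθ) (hp.subst θ) (ih₁ hθ) (ih₂ hθ)
  | unitM _ hf ih => exact .unitM (ih hθ) hf
  | vunitM hv _ ih => exact .vunitM (hv.tsubst θ) (ih hθ)
  | bindM _ hp _ ih ih' => exact .bindM (ih hθ) (hp.subst θ) (ih' hθ)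
  | decl _ h₁ h₂ h₃ ih => exact .decl (ih hθ) h₁ h₂ h₃
  | endorse _ h₁ h₂ h₃ ih => exact .endorse (ih hθ) h₁ h₂ h₃

theorem tsubst_shift {n : ℕ} {Γ : List (Ty D)} {pc : Label D} {e : Tm D} {τ : Ty D}
    (h : HasType n Γ pc e τ) :
    HasType (n + 1) (Γ.map Ty.shift) pc (e.tsubst fun j => .tvar (j + 1)) τ.shift := by
  rw [Ty.shift_eq_subst, funext (f := Ty.shift) Ty.shift_eq_subst]
  exact h.tsubst fun _ => Nat.succ_lt_succ

theorem tsubst_single {n : ℕ} {Γ : List (Ty D)} {pc : Label D} {e : Tm D} {τ τ' : Ty D}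
    (h : HasType (n + 1) (Γ.map Ty.shift) pc e τ) (hw : τ'.WF n) :
    HasType n Γ pc (e.tsubst (Ty.single τ')) (τ.subst (Ty.single τ')) := by
  have hθ : ∀ k < n + 1, (Ty.single τ' k).WF n
    | 0, _ => hw
    | k + 1, hk => Nat.lt_of_succ_lt_succ hk
  simpa [List.map_map, Function.comp_def, Ty.shift_subst_single] using h.tsubst hθ

end HasType

/-- A renaming of term variables from the context `Γ` to the context `Δ`. -/
def RenamesCtx (Γ Δ : List (Ty D)) (ξ : ℕ → ℕ) : Prop :=
  ∀ (k : ℕ) (τ : Ty D), Γ[k]? = some τ → Δ[ξ k]? = some τ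

namespace RenamesCtx

variable {Γ Δ : List (Ty D)} {ξ : ℕ → ℕ}

theorem up (hξ : RenamesCtx Γ Δ ξ) (τ' : Ty D) : RenamesCtx (τ' :: Γ) (τ' :: Δ) (upRen ξ)
  | 0, _, hk => hk
  | k + 1, τ, hk => hξ k τ hk

theorem map (hξ : RenamesCtx Γ Δ ξ) (f : Ty D → Ty D) : RenamesCtx (Γ.map f) (Δ.map f) ξ := by
  intro k τ hk
  rw [List.getElem?_map, Option.map_eq_some_iff] at hk ⊢
  obtain ⟨τ₀, h₀, hτ⟩ := hk
  exact ⟨τ₀, hξ _ _ h₀, hτ⟩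

end RenamesCtx

theorem HasType.rename {n : ℕ} {Γ Δ : List (Ty D)} {pc : Label D} {e : Tm D} {τ : Ty D}
    {ξ : ℕ → ℕ} (h : HasType n Γ pc e τ) (hξ : RenamesCtx Γ Δ ξ) :
    HasType n Δ pc (e.rename ξ) τ := by
  induction h generalizing Δ ξ with
  | var h => exact .var (hξ _ _ h)
  | unit => exact .unit
  | lam _ ih => exact .lam (ih (hξ.up _))
  | app _ _ hf ih₁ ih₂ => exact .app (ih₁ hξ) (ih₂ hξ) hf
  | tlam _ ih => exact .tlam (ih (hξ.map _))
  | tapp _ hf hw ih => exact .tapp (ih hξ) hf hw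
  | pair _ _ ih₁ ih₂ => exact .pair (ih₁ hξ) (ih₂ hξ)
  | proj _ ih => exact .proj (ih hξ)
  | inj _ ih => exact .inj (ih hξ)
  | case _ hp _ _ ih ih₁ ih₂ => exact .case (ih hξ) hp (ih₁ (hξ.up _)) (ih₂ (hξ.up _))
  | unitM _ hf ih => exact .unitM (ih hξ) hf
  | vunitM hv _ ih => exact .vunitM (hv.rename ξ) (ih hξ)
  | bindM _ hp _ ih ih' => exact .bindM (ih hξ) hp (ih' (hξ.up _))
  | decl _ h₁ h₂ h₃ ih => exact .decl (ih hξ) h₁ h₂ h₃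
  | endorse _ h₁ h₂ h₃ ih => exact .endorse (ih hξ) h₁ h₂ h₃

/-- A substitution of terms in the context `Δ` for the variables of the context `Γ`.  The terms
are typed at every program counter label because substitution carries them into bodies that are
checked at other labels; variables and values are. -/
def SubstitutesCtx (n : ℕ) (Γ Δ : List (Ty D)) (σ : ℕ → Tm D) : Prop :=
  ∀ (k : ℕ) (τ : Ty D), Γ[k]? = some τ → ∀ pc, HasType n Δ pc (σ k) τ

namespace SubstitutesCtx

variable {n : ℕ} {Γ Δ : List (Ty D)} {σ : ℕ → Tm D}

theorem up (hσ : SubstitutesCtx n Γ Δ σ) (τ' : Ty D) :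
    SubstitutesCtx n (τ' :: Γ) (τ' :: Δ) (Tm.up σ)
  | 0, _, hk, _ => .var hk
  | k + 1, τ, hk, pc => (hσ k τ hk pc).rename fun _ _ h => h

theorem shift (hσ : SubstitutesCtx n Γ Δ σ) :
    SubstitutesCtx (n + 1) (Γ.map Ty.shift) (Δ.map Ty.shift)
      fun k => (σ k).tsubst fun j => .tvar (j + 1) := by
  intro k τ hk pc
  rw [List.getElem?_map, Option.map_eq_some_iff] at hk
  obtain ⟨τ₀, h₀, rfl⟩ := hk
  exact (hσ _ _ h₀ pc).tsubst_shift

end SubstitutesCtx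

namespace HasType

theorem subst {n : ℕ} {Γ Δ : List (Ty D)} {pc : Label D} {e : Tm D} {τ : Ty D} {σ : ℕ → Tm D}
    (h : HasType n Γ pc e τ) (hσ : SubstitutesCtx n Γ Δ σ) : HasType n Δ pc (e.subst σ) τ := by
  induction h generalizing Δ σ with
  | var h => exact hσ _ _ h _
  | unit => exact .unit
  | lam _ ih => exact .lam (ih (hσ.up _))
  | app _ _ hf ih₁ ih₂ => exact .app (ih₁ hσ) (ih₂ hσ) hf
  | tlam _ ih => exact .tlam (ih hσ.shift)
  | tapp _ hf hw ih => exact .tapp (ih hσ) hf hw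
  | pair _ _ ih₁ ih₂ => exact .pair (ih₁ hσ) (ih₂ hσ)
  | proj _ ih => exact .proj (ih hσ)
  | inj _ ih => exact .inj (ih hσ)
  | case _ hp _ _ ih ih₁ ih₂ => exact .case (ih hσ) hp (ih₁ (hσ.up _)) (ih₂ (hσ.up _))
  | unitM _ hf ih => exact .unitM (ih hσ) hf
  | vunitM hv _ ih => exact .vunitM (hv.subst σ) (ih hσ)
  | bindM _ hp _ ih ih' => exact .bindM (ih hσ) hp (ih' (hσ.up _))
  | decl _ h₁ h₂ h₃ ih => exact .decl (ih hσ) h₁ h₂ h₃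
  | endorse _ h₁ h₂ h₃ ih => exact .endorse (ih hσ) h₁ h₂ h₃

theorem inst {n : ℕ} {Γ : List (Ty D)} {pc pc' : Label D} {e v : Tm D} {τ τ' : Ty D}
    (h : HasType n (τ' :: Γ) pc e τ) (hv : v.IsValue) (hvt : HasType n Γ pc' v τ') :
    HasType n Γ pc (e.inst v) τ :=
  h.subst fun
    | 0, _, hk, pc => Option.some.inj hk ▸ hvt.value_pc hv pc
    | _ + 1, _, hk, _ => .var hk

theorem inst₂ {n : ℕ} {Γ : List (Ty D)} {pc : Label D} {e v w : Tm D} {τ τx τy : Ty D}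
    (h : HasType n (τy :: τx :: Γ) pc e τ) (hv : IsInput n Γ pc τx v)
    (hw : IsInput n Γ pc τy w) : HasType n Γ pc (e.inst₂ v w) τ :=
  h.subst fun
    | 0, _, hk, pc => Option.some.inj hk ▸ hw.2.value_pc hw.1 pc
    | 1, _, hk, pc => Option.some.inj hk ▸ hv.2.value_pc hv.1 pc
    | _ + 2, _, hk, _ => .var hk

end HasType

/-! ## Erasure of invisible values -/

namespace Tm

open Classical in
/-- The normal form of a term for `Equiv Lo`: every value that is invisible at `Lo` is replaced by
the mark of its type. -/
noncomputable def erase (Lo : Set (Label D)) : Tm D → Tm D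
  | var k => var k
  | unit => unit
  | lam τ pc e => lam τ pc (e.erase Lo)
  | app e₁ e₂ => app (e₁.erase Lo) (e₂.erase Lo)
  | tlam pc e => tlam pc (e.erase Lo)
  | tapp e τ => tapp (e.erase Lo) τ
  | pair e₁ e₂ => pair (e₁.erase Lo) (e₂.erase Lo)
  | proj i e => proj i (e.erase Lo)
  | inj i τ₁ τ₂ e => inj i τ₁ τ₂ (e.erase Lo)
  | case e e₁ e₂ => case (e.erase Lo) (e₁.erase Lo) (e₂.erase Lo)
  | ret l τ e => ret l τ (e.erase Lo)
  | vret l τ v => if l ∈ Lo then vret l τ (v.erase Lo) else bullet (.labeled l τ)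
  | bind e e' => bind (e.erase Lo) (e'.erase Lo)
  | decl e l => decl (e.erase Lo) l
  | endorse e l => endorse (e.erase Lo) l
  | bullet τ => bullet τ

variable {Lo Lo' : Set (Label D)} {e e' : Tm D}

theorem erase_vret_of_mem {l : Label D} (hl : l ∈ Lo) (τ : Ty D) (v : Tm D) :
    (vret l τ v).erase Lo = vret l τ (v.erase Lo) :=
  if_pos hl

theorem erase_vret_of_notMem {l : Label D} (hl : l ∉ Lo) (τ : Ty D) (v : Tm D) :
    (vret l τ v).erase Lo = bullet (.labeled l τ) :=
  if_neg hl

theorem erase_erase_of_subset (h : Lo' ⊆ Lo) (e : Tm D) : (e.erase Lo).erase Lo' = e.erase Lo' := by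
  induction e with
  | vret l τ v ih =>
    by_cases hl : l ∈ Lo
    · by_cases hl' : l ∈ Lo' <;> simp [erase, hl, hl', ih]
    · have hl' : l ∉ Lo' := fun hl' => hl (h hl')
      simp [erase, hl, hl']
  | _ => simp_all [erase]

theorem equiv_erase (Lo : Set (Label D)) (e : Tm D) : Equiv Lo e (e.erase Lo) := by
  induction e with
  | vret l τ v ih =>
    by_cases hl : l ∈ Lo
    · exact erase_vret_of_mem hl τ v ▸ .vret ih
    · exact erase_vret_of_notMem hl τ v ▸ .hide hl
  | var | unit | bullet => exact .refl _
  | lam _ _ _ ih => exact .lam ih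
  | app _ _ ih₁ ih₂ => exact .app ih₁ ih₂
  | tlam _ _ ih => exact .tlam ih
  | tapp _ _ ih => exact .tapp ih
  | pair _ _ ih₁ ih₂ => exact .pair ih₁ ih₂
  | proj _ _ ih => exact .proj ih
  | inj _ _ _ _ ih => exact .inj ih
  | case _ _ _ ih ih₁ ih₂ => exact .case ih ih₁ ih₂
  | ret _ _ _ ih => exact .ret ih
  | bind _ _ ih₁ ih₂ => exact .bind ih₁ ih₂
  | decl _ _ ih => exact .decl ih
  | endorse _ _ ih => exact .endorse ih

theorem equiv_iff_erase_eq : Equiv Lo e e' ↔ e.erase Lo = e'.erase Lo := by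
  refine ⟨fun h => ?_, fun h => .trans (e.equiv_erase Lo) (h ▸ .symm (e'.equiv_erase Lo))⟩
  induction h with
  | hide hl => exact erase_vret_of_notMem hl ..
  | trans _ _ ih₁ ih₂ => exact ih₁.trans ih₂
  | _ => simp_all [erase]

theorem erase_rename (Lo : Set (Label D)) (e : Tm D) (ξ : ℕ → ℕ) :
    (e.rename ξ).erase Lo = (e.erase Lo).rename ξ := by
  induction e generalizing ξ with
  | vret l τ v ih => by_cases hl : l ∈ Lo <;> simp [erase, rename, hl, ih]
  | _ => simp_all [erase, rename]

theorem erase_tsubst (Lo : Set (Label D)) (e : Tm D) (θ : ℕ → Ty D) :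
    (e.tsubst θ).erase Lo = (e.erase Lo).tsubst θ := by
  induction e generalizing θ with
  | vret l τ v ih => by_cases hl : l ∈ Lo <;> simp [erase, tsubst, hl, ih, Ty.subst]
  | _ => simp_all [erase, tsubst]

theorem erase_up (Lo : Set (Label D)) (σ : ℕ → Tm D) :
    (fun k => (up σ k).erase Lo) = up fun k => (σ k).erase Lo := by
  funext k
  cases k with
  | zero => rfl
  | succ k => exact erase_rename Lo _ _

theorem erase_subst (Lo : Set (Label D)) (e : Tm D) (σ : ℕ → Tm D) :
    (e.subst σ).erase Lo = (e.erase Lo).subst fun k => (σ k).erase Lo := by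
  induction e generalizing σ with
  | vret l τ v ih => by_cases hl : l ∈ Lo <;> simp [erase, subst, hl, ih]
  | _ => simp_all [erase, subst, erase_up, erase_tsubst]

theorem erase_inst (Lo : Set (Label D)) (e v : Tm D) :
    (e.inst v).erase Lo = (e.erase Lo).inst (v.erase Lo) := by
  rw [inst, inst, erase_subst]
  congr 1
  funext k
  cases k <;> rfl

theorem erase_inst₂ (Lo : Set (Label D)) (e v w : Tm D) :
    (e.inst₂ v w).erase Lo = (e.erase Lo).inst₂ (v.erase Lo) (w.erase Lo) := by
  rw [inst₂, inst₂, erase_subst]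
  congr 1
  funext k
  match k with
  | 0 | 1 | _ + 2 => rfl

section Inversion

variable {a b c : Tm D} {τ τ₁ τ₂ : Ty D} {l pc : Label D} {i : Bool}

theorem erase_eq_unit_iff : e.erase Lo = unit ↔ e = unit := by
  cases e <;> grind [erase]

theorem erase_eq_lam_iff :
    e.erase Lo = lam τ pc a ↔ ∃ e₁, e = lam τ pc e₁ ∧ e₁.erase Lo = a := by
  cases e <;> grind [erase]

theorem erase_eq_app_iff :
    e.erase Lo = app a b ↔ ∃ e₁ e₂, e = app e₁ e₂ ∧ e₁.erase Lo = a ∧ e₂.erase Lo = b := by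
  cases e <;> grind [erase]

theorem erase_eq_tlam_iff :
    e.erase Lo = tlam pc a ↔ ∃ e₁, e = tlam pc e₁ ∧ e₁.erase Lo = a := by
  cases e <;> grind [erase]

theorem erase_eq_tapp_iff :
    e.erase Lo = tapp a τ ↔ ∃ e₁, e = tapp e₁ τ ∧ e₁.erase Lo = a := by
  cases e <;> grind [erase]

theorem erase_eq_pair_iff :
    e.erase Lo = pair a b ↔ ∃ e₁ e₂, e = pair e₁ e₂ ∧ e₁.erase Lo = a ∧ e₂.erase Lo = b := by
  cases e <;> grind [erase]

theorem erase_eq_proj_iff :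
    e.erase Lo = proj i a ↔ ∃ e₁, e = proj i e₁ ∧ e₁.erase Lo = a := by
  cases e <;> grind [erase]

theorem erase_eq_inj_iff :
    e.erase Lo = inj i τ₁ τ₂ a ↔ ∃ e₁, e = inj i τ₁ τ₂ e₁ ∧ e₁.erase Lo = a := by
  cases e <;> grind [erase]

theorem erase_eq_case_iff :
    e.erase Lo = case a b c ↔ ∃ e₀ e₁ e₂, e = case e₀ e₁ e₂ ∧
      e₀.erase Lo = a ∧ e₁.erase Lo = b ∧ e₂.erase Lo = c := by
  cases e <;> grind [erase]

theorem erase_eq_ret_iff :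
    e.erase Lo = ret l τ a ↔ ∃ e₁, e = ret l τ e₁ ∧ e₁.erase Lo = a := by
  cases e <;> grind [erase]

theorem erase_eq_bind_iff :
    e.erase Lo = bind a b ↔ ∃ e₁ e₂, e = bind e₁ e₂ ∧ e₁.erase Lo = a ∧ e₂.erase Lo = b := by
  cases e <;> grind [erase]

theorem erase_eq_decl_iff :
    e.erase Lo = decl a l ↔ ∃ e₁, e = decl e₁ l ∧ e₁.erase Lo = a := by
  cases e <;> grind [erase]

theorem erase_eq_endorse_iff :
    e.erase Lo = endorse a l ↔ ∃ e₁, e = endorse e₁ l ∧ e₁.erase Lo = a := by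
  cases e <;> grind [erase]

theorem erase_eq_erase_vret_iff {v : Tm D} :
    e.erase Lo = (vret l τ v).erase Lo ↔
      (∃ v', e = vret l τ v' ∧ (l ∈ Lo → v'.erase Lo = v.erase Lo)) ∨
        l ∉ Lo ∧ e = bullet (.labeled l τ) := by
  by_cases hl : l ∈ Lo <;> cases e <;> grind [erase]

theorem erase_vret_eq_iff {l' : Label D} {τ' : Ty D} {v v' : Tm D} :
    (vret l τ v).erase Lo = (vret l' τ' v').erase Lo ↔
      l = l' ∧ τ = τ' ∧ (l ∈ Lo → v.erase Lo = v'.erase Lo) := by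
  by_cases hl : l ∈ Lo <;> by_cases hl' : l' ∈ Lo <;> grind [erase]

end Inversion

theorem DeclFree.rename (h : e.DeclFree) (ξ : ℕ → ℕ) : (e.rename ξ).DeclFree := by
  induction e generalizing ξ <;> simp_all [DeclFree, Tm.rename]

theorem DeclFree.tsubst (h : e.DeclFree) (θ : ℕ → Ty D) : (e.tsubst θ).DeclFree := by
  induction e generalizing θ <;> simp_all [DeclFree, Tm.tsubst]

theorem DeclFree.up {σ : ℕ → Tm D} (hσ : ∀ k, (σ k).DeclFree) : ∀ k, (Tm.up σ k).DeclFree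
  | 0 => trivial
  | k + 1 => (hσ k).rename _

theorem DeclFree.subst {σ : ℕ → Tm D} (h : e.DeclFree) (hσ : ∀ k, (σ k).DeclFree) :
    (e.subst σ).DeclFree := by
  induction e generalizing σ with
  | var k => exact hσ k
  | lam τ pc e ih => exact ih h (DeclFree.up hσ)
  | tlam pc e ih => exact ih h fun k => (hσ k).tsubst _
  | case e e₁ e₂ ih ih₁ ih₂ =>
    exact ⟨ih h.1 hσ, ih₁ h.2.1 (DeclFree.up hσ), ih₂ h.2.2 (DeclFree.up hσ)⟩
  | bind e e' ih ih' => exact ⟨ih h.1 hσ, ih' h.2 (DeclFree.up hσ)⟩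
  | _ => simp_all [DeclFree, Tm.subst]

theorem DeclFree.inst {v : Tm D} (h : e.DeclFree) (hv : v.DeclFree) : (e.inst v).DeclFree :=
  h.subst fun
    | 0 => hv
    | _ + 1 => trivial

theorem DeclFree.inst₂ {v w : Tm D} (h : e.DeclFree) (hv : v.DeclFree) (hw : w.DeclFree) :
    (e.inst₂ v w).DeclFree :=
  h.subst fun
    | 0 => hw
    | 1 => hv
    | _ + 2 => trivial

theorem DeclFree.erase (h : e.DeclFree) (Lo : Set (Label D)) : (e.erase Lo).DeclFree := by
  induction e with
  | vret l τ v ih => by_cases hl : l ∈ Lo <;> simp_all [Tm.erase, DeclFree]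
  | _ => simp_all [Tm.erase, DeclFree]

end Tm

theorem HasType.unique_of_erase_eq {Lo : Set (Label D)} {n : ℕ} {Γ : List (Ty D)}
    {pc pc' : Label D} {e e' : Tm D} {τ τ' : Ty D} (h : HasType n Γ pc e τ)
    (h' : HasType n Γ pc' e' τ') (he : e.erase Lo = e'.erase Lo) : τ = τ' := by
  induction h generalizing pc' e' τ' with
  | @vunitM _ _ _ l =>
    by_cases hl : l ∈ Lo <;> cases h' <;> simp [Tm.erase, hl] at he <;> grind
  | _ => cases h' <;> simp [Tm.erase] at he <;> grind

/-! ## Visible parts of traces -/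

/-- At `Lo`, the term looks like a single invisible labelled value. -/
def Tm.Hidden (Lo : Set (Label D)) (v : Tm D) : Prop :=
  ∃ l τ, l ∉ Lo ∧ v.erase Lo = .bullet (.labeled l τ)

namespace Event

variable {Lo Lo' : Set (Label D)}

open Classical in
/-- The part of an event that is visible at `Lo`, if any, in a normal form for `EventEquiv Lo`. -/
noncomputable def visible (Lo : Set (Label D)) : Event D → Option (Event D)
  | bullet => none
  | val v => if v.Hidden Lo then none else some (val (v.erase Lo))
  | down π l' l τ v => if l ∈ Lo then some (down π l' l τ (v.erase Lo)) else none

theorem visible_val_of_hidden {v : Tm D} (h : v.Hidden Lo) : (val v).visible Lo = none :=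
  if_pos h

theorem visible_val_of_not_hidden {v : Tm D} (h : ¬ v.Hidden Lo) :
    (val v).visible Lo = some (val (v.erase Lo)) :=
  if_neg h

theorem visible_val_congr {v v' : Tm D} (h : v.erase Lo = v'.erase Lo) :
    (val v).visible Lo = (val v').visible Lo := by
  by_cases hv : v.Hidden Lo
  · have hv' : v'.Hidden Lo := by rwa [Tm.Hidden, ← h]
    rw [visible_val_of_hidden hv, visible_val_of_hidden hv']
  · have hv' : ¬ v'.Hidden Lo := by rwa [Tm.Hidden, ← h]
    rw [visible_val_of_not_hidden hv, visible_val_of_not_hidden hv', h]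

theorem visible_val_vret_of_notMem {l : Label D} (hl : l ∉ Lo) (τ : Ty D) (v : Tm D) :
    (val (.vret l τ v)).visible Lo = none :=
  visible_val_of_hidden ⟨l, τ, hl, Tm.erase_vret_of_notMem hl τ v⟩

theorem visible_down_of_mem {l : Label D} (hl : l ∈ Lo) (π : Aspect) (l' : Label D) (τ : Ty D)
    (v : Tm D) : (down π l' l τ v).visible Lo = some (down π l' l τ (v.erase Lo)) :=
  if_pos hl

theorem visible_down_of_notMem {l : Label D} (hl : l ∉ Lo) (π : Aspect) (l' : Label D) (τ : Ty D)
    (v : Tm D) : (down π l' l τ v).visible Lo = none :=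
  if_neg hl

theorem visible_bind_visible (h : Lo' ⊆ Lo) (c : Event D) :
    (c.visible Lo).bind (visible Lo') = c.visible Lo' := by
  cases c with
  | bullet => rfl
  | val v =>
    by_cases hv : v.Hidden Lo
    · obtain ⟨l, τ, hl, hv'⟩ := id hv
      have hidden : v.Hidden Lo' :=
        ⟨l, τ, fun hl' => hl (h hl'), by rw [← Tm.erase_erase_of_subset h, hv', Tm.erase]⟩
      rw [visible_val_of_hidden hv, visible_val_of_hidden hidden, Option.bind_none]
    · rw [visible_val_of_not_hidden hv, Option.bind_some]
      exact visible_val_congr (Tm.erase_erase_of_subset h v)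
  | down π l' l τ v =>
    by_cases hl : l ∈ Lo
    · simp [visible, hl, Tm.erase_erase_of_subset h]
    · have hl' : l ∉ Lo' := fun hl' => hl (h hl')
      simp [visible, hl, hl']

end Event

section Visible

variable {Lo Lo' : Set (Label D)} {c c' : Event D} {s t t' : Trace D} {k : ℕ}

theorem eventEquiv_visible (Lo : Set (Label D)) (c : Event D) :
    EventEquiv Lo c ((c.visible Lo).getD .bullet) := by
  cases c with
  | bullet => exact .refl _
  | val v =>
    by_cases hv : v.Hidden Lo
    · rw [Event.visible_val_of_hidden hv]
      obtain ⟨l, τ, hl, hv⟩ := hv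
      refine .trans (.val (v' := .vret l τ .unit) ?_) (.hideVal hl)
      rw [Tm.equiv_iff_erase_eq, hv, Tm.erase_vret_of_notMem hl]
    · rw [Event.visible_val_of_not_hidden hv]
      exact .val (v.equiv_erase Lo)
  | down π l' l τ v =>
    by_cases hl : l ∈ Lo
    · rw [Event.visible_down_of_mem hl]
      exact .down (v.equiv_erase Lo)
    · rw [Event.visible_down_of_notMem hl]
      exact .hideDown hl

theorem eventEquiv_iff_visible_eq : EventEquiv Lo c c' ↔ c.visible Lo = c'.visible Lo := by
  refine ⟨fun h => ?_, fun h => .trans (eventEquiv_visible Lo c)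
    (h ▸ .symm (eventEquiv_visible Lo c'))⟩
  induction h with
  | hideVal hl => exact Event.visible_val_vret_of_notMem hl _ _
  | hideDown hl => exact Event.visible_down_of_notMem hl _ _ _ _
  | refl => rfl
  | symm _ ih => exact ih.symm
  | trans _ _ ih₁ ih₂ => exact ih₁.trans ih₂
  | val h => exact Event.visible_val_congr (Tm.equiv_iff_erase_eq.1 h)
  | down h => simp only [Event.visible, Tm.equiv_iff_erase_eq.1 h]

/-- The visible parts of the events of a trace, in a normal form for `TraceEquiv Lo`. -/
noncomputable def visibleTrace (Lo : Set (Label D)) (t : Trace D) : Trace D :=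
  t.filterMap (Event.visible Lo)

theorem visibleTrace_append (Lo : Set (Label D)) (s t : Trace D) :
    visibleTrace Lo (s ++ t) = visibleTrace Lo s ++ visibleTrace Lo t :=
  List.filterMap_append ..

theorem visibleTrace_cons (Lo : Set (Label D)) (c : Event D) (t : Trace D) :
    visibleTrace Lo (c :: t) = (c.visible Lo).toList ++ visibleTrace Lo t := by
  cases h : c.visible Lo <;> simp [visibleTrace, h]

theorem visibleTrace_cons_bullet (Lo : Set (Label D)) (t : Trace D) :
    visibleTrace Lo (.bullet :: t) = visibleTrace Lo t := rfl

theorem visibleTrace_singleton (Lo : Set (Label D)) (c : Event D) :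
    visibleTrace Lo [c] = (c.visible Lo).toList := by
  rw [visibleTrace_cons, visibleTrace, List.filterMap_nil, List.append_nil]

theorem visibleTrace_visibleTrace (h : Lo' ⊆ Lo) (t : Trace D) :
    visibleTrace Lo' (visibleTrace Lo t) = visibleTrace Lo' t := by
  rw [visibleTrace, visibleTrace, List.filterMap_filterMap]
  exact List.filterMap_congr fun c _ => Event.visible_bind_visible h c

theorem visibleTrace_eq_of_subset (h : Lo' ⊆ Lo) (hst : visibleTrace Lo s = visibleTrace Lo t) :
    visibleTrace Lo' s = visibleTrace Lo' t := by
  rw [← visibleTrace_visibleTrace h s, hst, visibleTrace_visibleTrace h t]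

theorem traceEquiv_visibleTrace (Lo : Set (Label D)) (t : Trace D) :
    TraceEquiv Lo t (visibleTrace Lo t) := by
  induction t with
  | nil => exact .refl _
  | cons c t ih =>
    have hc : TraceEquiv Lo [c] (c.visible Lo).toList := by
      have h := eventEquiv_visible Lo c
      cases hc : c.visible Lo <;> rw [hc] at h
      · exact .trans (.lift h) (.bulletL [])
      · exact .lift h
    rw [visibleTrace_cons]
    exact .append hc ih

theorem traceEquiv_iff_visibleTrace_eq :
    TraceEquiv Lo t t' ↔ visibleTrace Lo t = visibleTrace Lo t' := by
  refine ⟨fun h => ?_, fun h => .trans (traceEquiv_visibleTrace Lo t)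
    (h ▸ .symm (traceEquiv_visibleTrace Lo t'))⟩
  induction h with
  | lift h => simp only [visibleTrace_singleton, eventEquiv_iff_visible_eq.1 h]
  | bulletR t => rw [visibleTrace_append, visibleTrace_singleton]; exact List.append_nil _
  | bulletL t => rfl
  | refl => rfl
  | symm _ ih => exact ih.symm
  | trans _ _ ih₁ ih₂ => exact ih₁.trans ih₂
  | append _ _ ih₁ ih₂ => rw [visibleTrace_append, visibleTrace_append, ih₁, ih₂]

theorem visibleTrace_take_succ (Lo : Set (Label D)) {k : ℕ} (hk : t[k]? = some c) :
    visibleTrace Lo (t.take (k + 1)) =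
      visibleTrace Lo (t.take k) ++ (c.visible Lo).toList := by
  rw [List.take_add_one, hk, visibleTrace_append, Option.toList_some, visibleTrace_singleton]

/-- The event of `t` at position `k` is visible at `Lo`. -/
def VisibleAt (Lo : Set (Label D)) (t : Trace D) (k : ℕ) : Prop :=
  ∃ c, t[k]? = some c ∧ c.visible Lo ≠ none

theorem VisibleAt.exists_eq_append (h : VisibleAt Lo t k) :
    ∃ a c b, t = a ++ c :: b ∧ a.length = k ∧ c.visible Lo ≠ none := by
  obtain ⟨c, hk, hc⟩ := h
  obtain ⟨hlt, rfl⟩ := List.getElem?_eq_some_iff.1 hk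
  exact ⟨t.take k, t[k], t.drop (k + 1), by simp, by simp [hlt.le], hc⟩

theorem visibleAt_append_cons (hc : c.visible Lo ≠ none) (s t : Trace D) :
    VisibleAt Lo (s ++ c :: t) s.length :=
  ⟨c, by simp, hc⟩

theorem VisibleAt.exists_of_visibleTrace_eq (h : VisibleAt Lo t k)
    (ht : visibleTrace Lo t = visibleTrace Lo t') :
    ∃ k', VisibleAt Lo t' k' ∧ visibleTrace Lo (t'.take k') = visibleTrace Lo (t.take k) := by
  obtain ⟨a, c, b, rfl, rfl, hc⟩ := h.exists_eq_append
  obtain ⟨d, hd⟩ := Option.ne_none_iff_exists'.1 hc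
  rw [visibleTrace_append, visibleTrace_cons, hd] at ht
  obtain ⟨a₁, r, rfl, ha₁, hr⟩ := List.filterMap_eq_append_iff.1 ht.symm
  obtain ⟨a₂, c', b', rfl, ha₂, hc', -⟩ := List.filterMap_eq_cons_iff.1 hr
  refine ⟨(a₁ ++ a₂).length, ?_, ?_⟩
  · rw [← List.append_assoc]
    exact visibleAt_append_cons (by simp [hc']) _ _
  · have : visibleTrace Lo a₂ = [] := List.filterMap_eq_nil_iff.2 ha₂
    rw [← List.append_assoc, List.take_left, List.take_left, visibleTrace_append, this,
      List.append_nil]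
    exact ha₁

theorem append_cons_inj_of_filterMap_eq {α β : Type*} {f : α → Option β} {x x' y y' : List α}
    {d d' : α} (h : x ++ d :: y = x' ++ d' :: y') (hd : f d ≠ none) (hd' : f d' ≠ none)
    (hx : x.filterMap f = x'.filterMap f) : x = x' ∧ d = d' := by
  induction x generalizing x' with
  | nil => cases x' <;> grind
  | cons a x ih => cases x' <;> grind

theorem VisibleAt.visibleTrace_take_succ_eq {k' : ℕ} (hsub : Lo' ⊆ Lo) (h : VisibleAt Lo' t k)
    (h' : VisibleAt Lo' t' k') (ht : visibleTrace Lo t = visibleTrace Lo t')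
    (hk : visibleTrace Lo' (t.take k) = visibleTrace Lo' (t'.take k')) :
    visibleTrace Lo (t.take (k + 1)) = visibleTrace Lo (t'.take (k' + 1)) := by
  have visible_at_both : ∀ c : Event D, c.visible Lo' ≠ none →
      ∃ d, c.visible Lo = some d ∧ d.visible Lo' ≠ none := by
    intro c hc
    rw [← Event.visible_bind_visible hsub c] at hc
    cases hd : c.visible Lo <;> simp_all
  obtain ⟨a, c, b, rfl, rfl, hc⟩ := h.exists_eq_append
  obtain ⟨a', c', b', rfl, rfl, hc'⟩ := h'.exists_eq_append
  obtain ⟨d, hd, hdv⟩ := visible_at_both c hc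
  obtain ⟨d', hd', hdv'⟩ := visible_at_both c' hc'
  rw [List.take_left, List.take_left, ← visibleTrace_visibleTrace hsub a,
    ← visibleTrace_visibleTrace hsub a'] at hk
  rw [visibleTrace_append, visibleTrace_append, visibleTrace_cons, visibleTrace_cons, hd, hd'] at ht
  obtain ⟨ha, rfl⟩ := append_cons_inj_of_filterMap_eq ht hdv hdv' hk
  rw [visibleTrace_take_succ (c := c) Lo (by simp), visibleTrace_take_succ (c := c') Lo (by simp),
    List.take_left, List.take_left, ha, hd, hd']

end Visible

/-! ## Labels below and above an attacker -/

namespace Authority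

theorem ActsFor.refl (a : Authority D) : a.ActsFor a := by
  obtain ⟨p⟩ := a
  exact Form.ActsFor.refl p

theorem ActsFor.trans {a b c : Authority D} (h : a.ActsFor b) (k : b.ActsFor c) :
    a.ActsFor c := by
  obtain ⟨p⟩ := a
  obtain ⟨q⟩ := b
  obtain ⟨r⟩ := c
  exact Form.ActsFor.trans h k

theorem actsFor_bot (a : Authority D) : a.ActsFor .bot := by
  obtain ⟨p⟩ := a
  exact Form.ActsFor.bot p

theorem conj_actsFor_left (a b : Authority D) : (a.conj b).ActsFor a := by
  obtain ⟨p⟩ := a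
  obtain ⟨q⟩ := b
  exact Form.ActsFor.conjL₁ (.refl p)

theorem conj_actsFor_right (a b : Authority D) : (a.conj b).ActsFor b := by
  obtain ⟨p⟩ := a
  obtain ⟨q⟩ := b
  exact Form.ActsFor.conjL₂ (.refl q)

theorem actsFor_conj {a b c : Authority D} (h : a.ActsFor b) (k : a.ActsFor c) :
    a.ActsFor (b.conj c) := by
  obtain ⟨p⟩ := a
  obtain ⟨q⟩ := b
  obtain ⟨r⟩ := c
  exact Form.ActsFor.conjR h k

theorem actsFor_disj_left (a b : Authority D) : a.ActsFor (a.disj b) := by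
  obtain ⟨p⟩ := a
  obtain ⟨q⟩ := b
  exact Form.ActsFor.disjR₁ (.refl p)

theorem actsFor_disj_right (a b : Authority D) : b.ActsFor (a.disj b) := by
  obtain ⟨p⟩ := a
  obtain ⟨q⟩ := b
  exact Form.ActsFor.disjR₂ (.refl q)

end Authority

theorem Label.flowsTo_join_left (l m : Label D) : l.FlowsTo (l.join m) :=
  ⟨Authority.conj_actsFor_left _ _, Authority.actsFor_disj_left _ _⟩

theorem Label.flowsTo_join_right (l m : Label D) : m.FlowsTo (l.join m) :=
  ⟨Authority.conj_actsFor_right _ _, Authority.actsFor_disj_right _ _⟩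

/-- Information does not flow from outside `Lo` into `Lo`. -/
def FlowClosed (Lo : Set (Label D)) : Prop := ∀ l m : Label D, l.FlowsTo m → l ∉ Lo → m ∉ Lo

/-- The typing rules permit, under some program counter, a downgrade of aspect `π` from `l'`
to `l`: a declassification for `π = →` and an endorsement for `π = ←`. -/
def Downgradable : Aspect → Label D → Label D → Prop
  | .conf, l', l => l'.proj .integ = l.proj .integ ∧ ∃ pc : Label D,
      (l'.proj .conf).FlowsTo ((l.proj .conf).join ((l'.join pc).proj .integ).view)
  | .integ, l', l => l'.proj .conf = l.proj .conf ∧ ∃ pc : Label D,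
      (l'.proj .integ).FlowsTo ((l.proj .integ).join ((l'.join pc).proj .conf).voice)

theorem mem_trusted_of_downgradable_conf {A : Set (Label D)} {l' l : Label D}
    (h : Downgradable .conf l' l) (hl : l ∈ trusted A) : l' ∈ trusted A := by
  rwa [trusted, Set.mem_compl_iff, untrusted, Set.mem_ofPred_eq, h.1]

theorem mem_public_of_downgradable_integ {A : Set (Label D)} {l' l : Label D}
    (h : Downgradable .integ l' l) (hl : l ∈ (secret A)ᶜ) : l' ∈ (secret A)ᶜ := by
  rwa [Set.mem_compl_iff, secret, Set.mem_ofPred_eq, h.1]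

namespace IsAttacker

variable {A : Set (Label D)}

theorem flowClosed_trusted (hA : IsAttacker A) : FlowClosed (trusted A) := by
  intro l m h hl
  rw [trusted, Set.notMem_compl_iff] at hl ⊢
  exact hA.closed _ hl _ ⟨.refl _, h.2⟩

theorem flowClosed_public (hA : IsAttacker A) : FlowClosed (secret A)ᶜ := by
  intro l m h hl
  rw [Set.notMem_compl_iff] at hl ⊢
  exact fun hm => hl (hA.closed _ hm _ ⟨h.1, .refl _⟩)

theorem mem_aspectOf_integ_iff (hA : IsAttacker A) {l : Label D} :
    l ∈ aspectOf A .integ ↔ l.proj .integ ∈ A := by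
  constructor
  · rintro ⟨q, hq⟩
    exact hA.closed _ hq _ ⟨Authority.actsFor_bot _, Authority.conj_actsFor_left _ _⟩
  · intro hl
    exact ⟨.bot, hA.closed _ hl _ ⟨Authority.actsFor_conj (.refl _) (.refl _),
      Authority.actsFor_conj (.refl _) (Authority.actsFor_bot _)⟩⟩

theorem proj_conf_mem_of_voice_mem (hA : IsAttacker A) {l : Label D}
    (h : (l.proj .conf).voice ∈ A) : l.proj .conf ∈ A :=
  hA.closed _ (hA.voice_view _ h) _
    ⟨Authority.conj_actsFor_right .bot l.conf, Authority.actsFor_bot _⟩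

/-- If `l'` is untrusted, then so is its voice joined with `l`; as `l` is trusted, the attacker
must have the voice, hence the confidentiality, of `l'`. -/
theorem mem_lowSet_of_downgradable_integ (hA : IsAttacker A) {l' l : Label D}
    (h : Downgradable .integ l' l) (hl' : l' ∉ trusted A) (hl : l ∈ trusted A) : l ∈ lowSet A := by
  obtain ⟨hconf, pc, hflow⟩ := h
  set m : Label D := ((l'.join pc).proj .conf).voice
  rw [trusted, Set.notMem_compl_iff] at hl'
  have disj_mem : l.disj m ∈ aspectOf A .integ :=
    hA.mem_aspectOf_integ_iff.2 (hA.closed _ hl' _ ⟨.refl _, hflow.2⟩)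
  have l_notMem : l ∉ aspectOf A .integ := fun h => hl (hA.mem_aspectOf_integ_iff.1 h)
  have m_mem : m ∈ aspectOf A .integ := by
    by_contra h
    exact hA.disj_not_mem _ _ l_notMem _ h disj_mem
  have join_mem : (l'.join pc).proj .conf ∈ A :=
    hA.proj_conf_mem_of_voice_mem (hA.mem_aspectOf_integ_iff.1 m_mem)
  have l'_mem : l'.proj .conf ∈ A :=
    hA.closed _ join_mem _ ⟨Authority.conj_actsFor_left _ _, .refl _⟩
  exact ⟨hl, fun hs => hs (hconf ▸ l'_mem)⟩

end IsAttacker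

/-! ## Big-step evaluation -/

/-- `Eval e u t`: the expression `e` evaluates to the value `u` and emits the events `t`.  Unlike a
sequence of steps, it has one derivation per redex and so supports induction on runs. -/
inductive Eval : Tm D → Tm D → Trace D → Prop where
  | unit : Eval .unit .unit []
  | lam {τ : Ty D} {pc : Label D} {e : Tm D} : Eval (.lam τ pc e) (.lam τ pc e) []
  | tlam {pc : Label D} {e : Tm D} : Eval (.tlam pc e) (.tlam pc e) []
  | vret {l : Label D} {τ : Ty D} {v : Tm D} : v.IsValue → Eval (.vret l τ v) (.vret l τ v) []
  | app {e₁ e₂ b v u : Tm D} {τ : Ty D} {pc : Label D} {t₁ t₂ t₃ : Trace D} :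
      Eval e₁ (.lam τ pc b) t₁ → Eval e₂ v t₂ → Eval (b.inst v) u t₃ →
      Eval (.app e₁ e₂) u (t₁ ++ (t₂ ++ .bullet :: t₃))
  | tapp {e b u : Tm D} {τ : Ty D} {pc : Label D} {t₁ t₂ : Trace D} :
      Eval e (.tlam pc b) t₁ → Eval (b.tsubst (Ty.single τ)) u t₂ →
      Eval (.tapp e τ) u (t₁ ++ .bullet :: t₂)
  | pair {e₁ e₂ v₁ v₂ : Tm D} {t₁ t₂ : Trace D} : Eval e₁ v₁ t₁ → Eval e₂ v₂ t₂ →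
      Eval (.pair e₁ e₂) (.pair v₁ v₂) (t₁ ++ t₂)
  | proj {i : Bool} {e v₁ v₂ : Tm D} {t : Trace D} : Eval e (.pair v₁ v₂) t →
      Eval (.proj i e) (bif i then v₂ else v₁) (t ++ [.bullet])
  | inj {i : Bool} {τ₁ τ₂ : Ty D} {e v : Tm D} {t : Trace D} : Eval e v t →
      Eval (.inj i τ₁ τ₂ e) (.inj i τ₁ τ₂ v) t
  | case {i : Bool} {τ₁ τ₂ : Ty D} {e e₁ e₂ v u : Tm D} {t₁ t₂ : Trace D} :
      Eval e (.inj i τ₁ τ₂ v) t₁ → Eval ((bif i then e₂ else e₁).inst v) u t₂ →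
      Eval (.case e e₁ e₂) u (t₁ ++ .bullet :: t₂)
  | ret {l : Label D} {τ : Ty D} {e v : Tm D} {t : Trace D} : Eval e v t →
      Eval (.ret l τ e) (.vret l τ v) (t ++ [.val (.vret l τ v)])
  | bind {l : Label D} {τ : Ty D} {e e' v u : Tm D} {t₁ t₂ : Trace D} :
      Eval e (.vret l τ v) t₁ → Eval (e'.inst v) u t₂ →
      Eval (.bind e e') u (t₁ ++ .bullet :: t₂)
  | decl {l' l : Label D} {τ : Ty D} {e v : Tm D} {t : Trace D} : Eval e (.vret l' τ v) t →
      Eval (.decl e l) (.vret l τ v) (t ++ [.down .conf l' l τ v])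
  | endorse {l' l : Label D} {τ : Ty D} {e v : Tm D} {t : Trace D} : Eval e (.vret l' τ v) t →
      Eval (.endorse e l) (.vret l τ v) (t ++ [.down .integ l' l τ v])

theorem Tm.IsValue.eval {v : Tm D} (h : v.IsValue) : Eval v v [] := by
  induction h with
  | unit => exact .unit
  | inj _ ih => exact .inj ih
  | pair _ _ ih₁ ih₂ => exact .pair ih₁ ih₂
  | vret h _ => exact .vret h
  | lam => exact .lam
  | tlam => exact .tlam

theorem Tm.IsValue.eq_of_eval {v u : Tm D} {t : Trace D} (h : v.IsValue) (hb : Eval v u t) :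
    u = v ∧ t = [] := by
  induction h generalizing u t with
  | inj _ ih => cases hb with | inj hb => simp [ih hb]
  | pair _ _ ih₁ ih₂ => cases hb with | pair h₁ h₂ => simp [ih₁ h₁, ih₂ h₂]
  | _ => cases hb; exact ⟨rfl, rfl⟩

theorem Eval.isValue {e u : Tm D} {t : Trace D} (h : Eval e u t) : u.IsValue := by
  induction h with
  | unit => exact .unit
  | lam => exact .lam
  | tlam => exact .tlam
  | vret h => exact .vret h
  | app _ _ _ _ _ ih => exact ih
  | tapp _ _ _ ih => exact ih
  | pair _ _ ih₁ ih₂ => exact .pair ih₁ ih₂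
  | @proj i _ _ _ _ _ ih =>
    cases ih
    cases i <;> assumption
  | inj _ ih => exact .inj ih
  | case _ _ _ ih => exact ih
  | ret _ ih => exact .vret ih
  | bind _ _ _ ih => exact ih
  | decl _ ih | endorse _ ih =>
    cases ih
    exact .vret ‹_›

theorem Eval.fill {e e' : Tm D} {c : Event D}
    (h : ∀ u t, Eval e' u t → Eval e u (c :: t)) (E : ECtx D) {u : Tm D} {t : Trace D}
    (hb : Eval (E.fill e') u t) : Eval (E.fill e) u (c :: t) := by
  induction E generalizing u t with
  | hole => exact h _ _ hb
  | appL E a ih => cases hb with | app h₁ h₂ h₃ => exact .app (ih h₁) h₂ h₃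
  | appR v hv E ih =>
    cases hb with
    | app h₁ h₂ h₃ =>
      obtain ⟨rfl, rfl⟩ := hv.eq_of_eval h₁
      exact .app h₁ (ih h₂) h₃
  | tapp E τ ih => cases hb with | tapp h₁ h₂ => exact .tapp (ih h₁) h₂
  | pairL E a ih => cases hb with | pair h₁ h₂ => exact .pair (ih h₁) h₂
  | pairR v hv E ih =>
    cases hb with
    | pair h₁ h₂ =>
      obtain ⟨rfl, rfl⟩ := hv.eq_of_eval h₁
      exact .pair h₁ (ih h₂)
  | ret l τ E ih => cases hb with | ret h₁ => exact .ret (ih h₁)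
  | proj i E ih => cases hb with | proj h₁ => exact .proj (ih h₁)
  | inj i τ₁ τ₂ E ih => cases hb with | inj h₁ => exact .inj (ih h₁)
  | bind E a ih => cases hb with | bind h₁ h₂ => exact .bind (ih h₁) h₂
  | case E a b ih => cases hb with | case h₁ h₂ => exact .case (ih h₁) h₂
  | decl E l ih => cases hb with | decl h₁ => exact .decl (ih h₁)
  | endorse E l ih => cases hb with | endorse h₁ => exact .endorse (ih h₁)

theorem Step.exists_eval_cons {p q : Tm D × Trace D} (h : Step p q) :
    ∃ c, q.2 = p.2 ++ [c] ∧ ∀ u t, Eval q.1 u t → Eval p.1 u (c :: t) := by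
  induction h with
  | red h =>
    refine ⟨.bullet, rfl, fun u t hb => ?_⟩
    cases h with
    | app hv => exact .app .lam hv.eval hb
    | tapp => exact .tapp .tlam hb
    | @proj i v₁ v₂ hv₁ hv₂ =>
      have hv : (bif i then v₂ else v₁).IsValue := by cases i <;> assumption
      obtain ⟨rfl, rfl⟩ := hv.eq_of_eval hb
      exact .proj (.pair hv₁.eval hv₂.eval)
    | case hv => exact .case (.inj hv.eval) hb
    | bind hv => exact .bind (.vret hv) hb
  | unitM hv =>
    refine ⟨_, rfl, fun u t hb => ?_⟩
    obtain ⟨rfl, rfl⟩ := (Tm.IsValue.vret hv).eq_of_eval hb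
    exact .ret hv.eval
  | decl hv =>
    refine ⟨_, rfl, fun u t hb => ?_⟩
    obtain ⟨rfl, rfl⟩ := (Tm.IsValue.vret hv).eq_of_eval hb
    exact .decl (.vret hv)
  | endorse hv =>
    refine ⟨_, rfl, fun u t hb => ?_⟩
    obtain ⟨rfl, rfl⟩ := (Tm.IsValue.vret hv).eq_of_eval hb
    exact .endorse (.vret hv)
  | eval E _ ih =>
    obtain ⟨c, hc, h⟩ := ih
    exact ⟨c, hc, fun u t hb => Eval.fill h E hb⟩

theorem Step.exists_eval_append {p q : Tm D × Trace D} (h : Relation.ReflTransGen Step p q)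
    (hq : q.1.IsValue) : ∃ s, q.2 = p.2 ++ s ∧ Eval p.1 q.1 s := by
  induction h using Relation.ReflTransGen.head_induction_on with
  | refl => exact ⟨[], (List.append_nil _).symm, hq.eval⟩
  | head h _ ih =>
    obtain ⟨c, hc, hstep⟩ := h.exists_eval_cons
    obtain ⟨s, hs, hb⟩ := ih
    exact ⟨c :: s, by rw [hs, hc, List.append_assoc, List.singleton_append], hstep _ _ hb⟩

theorem Runs.eval {e v w : Tm D} {t : Trace D} (h : Runs e v w t) :
    ∃ u s, t = .val v :: .val w :: s ∧ Eval (e.inst₂ v w) u s := by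
  obtain ⟨u, hu, hsteps⟩ := h
  obtain ⟨s, hs, hb⟩ := Step.exists_eval_append hsteps hu
  exact ⟨u, s, hs, hb⟩

section Eval

variable {Lo : Set (Label D)} {n : ℕ} {Γ : List (Ty D)} {pc : Label D} {e u : Tm D} {τ : Ty D}
  {t : Trace D}

theorem HasType.lam_inst {b v : Tm D} {τ₁ τ₂ σ : Ty D} {pc₁ pc₂ pc' : Label D}
    (h : HasType n Γ pc (.lam σ pc₁ b) (.fn τ₁ pc₂ τ₂)) (hv : v.IsValue)
    (hvt : HasType n Γ pc' v τ₁) : HasType n Γ pc₂ (b.inst v) τ₂ := by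
  cases h with | lam hb => exact hb.inst hv hvt

theorem HasType.tlam_tsubst_single {b : Tm D} {τ' : Ty D} {pc₁ pc₂ : Label D}
    (h : HasType n Γ pc (.tlam pc₁ b) (.all pc₂ τ)) (hw : τ'.WF n) :
    HasType n Γ pc₂ (b.tsubst (Ty.single τ')) (τ.subst (Ty.single τ')) := by
  cases h with | tlam hb => exact hb.tsubst_single hw

theorem HasType.inj_branch_inst {i : Bool} {τ₁ τ₂ σ₁ σ₂ : Ty D} {e₁ e₂ v : Tm D}
    {pc' : Label D} (h : HasType n Γ pc (.inj i σ₁ σ₂ v) (.sum τ₁ τ₂))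
    (hv : (Tm.inj i σ₁ σ₂ v).IsValue) (h₁ : HasType n (τ₁ :: Γ) pc' e₁ τ)
    (h₂ : HasType n (τ₂ :: Γ) pc' e₂ τ) :
    HasType n Γ pc' ((bif i then e₂ else e₁).inst v) τ := by
  cases hv with | inj hv =>
  cases h with | inj hvt =>
  cases i
  exacts [h₁.inst hv hvt, h₂.inst hv hvt]

theorem HasType.vret_inst {b v : Tm D} {τ' σ : Ty D} {l l' pc' : Label D}
    (h : HasType n Γ pc (.vret l' σ v) (.labeled l τ')) (hb : HasType n (τ' :: Γ) pc' b τ) :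
    HasType n Γ pc' (b.inst v) τ := by
  cases h with | vunitM hv hvt => exact hb.inst hv hvt

theorem Eval.hasType (hb : Eval e u t) (h : HasType n Γ pc e τ) : HasType n Γ pc u τ := by
  induction hb generalizing pc τ with
  | unit | lam | tlam | vret => exact h
  | app _ hb₂ hb₃ ih₁ ih₂ ih₃ =>
    cases h with | app h₁ h₂ _ =>
    exact (ih₃ ((ih₁ h₁).lam_inst hb₂.isValue (ih₂ h₂))).value_pc hb₃.isValue _
  | tapp _ hb₂ ih₁ ih₂ =>
    cases h with | tapp h₁ _ hw =>
    exact (ih₂ ((ih₁ h₁).tlam_tsubst_single hw)).value_pc hb₂.isValue _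
  | pair _ _ ih₁ ih₂ => cases h with | pair h₁ h₂ => exact .pair (ih₁ h₁) (ih₂ h₂)
  | @proj i _ _ _ _ _ ih =>
    cases h with | proj h =>
    cases ih h with | pair k₁ k₂ =>
    cases i <;> assumption
  | inj _ ih => cases h with | inj h => exact .inj (ih h)
  | case hb₁ _ ih₁ ih₂ =>
    cases h with | case h _ h₁ h₂ =>
    exact ih₂ ((ih₁ h).inj_branch_inst hb₁.isValue h₁ h₂)
  | ret hb ih => cases h with | unitM h _ => exact .vunitM hb.isValue (ih h)
  | bind _ hb₂ ih₁ ih₂ =>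
    cases h with | bindM h _ h' =>
    exact (ih₂ ((ih₁ h).vret_inst h')).value_pc hb₂.isValue _
  | decl _ ih =>
    cases h with | decl h _ _ _ =>
    cases ih h with | vunitM hv k =>
    exact .vunitM hv k
  | endorse _ ih =>
    cases h with | endorse h _ _ _ =>
    cases ih h with | vunitM hv k =>
    exact .vunitM hv k

theorem Eval.visibleTrace_eq_nil (hLo : FlowClosed Lo) (hb : Eval e u t) (h : HasType n Γ pc e τ)
    (hpc : pc ∉ Lo) : visibleTrace Lo t = [] := by
  induction hb generalizing pc τ with
  | unit | lam | tlam | vret => rfl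
  | app hb₁ hb₂ _ ih₁ ih₂ ih₃ =>
    cases h with | app h₁ h₂ hf =>
    have h₃ := (hb₁.hasType h₁).lam_inst hb₂.isValue (hb₂.hasType h₂)
    simp only [visibleTrace_append, visibleTrace_cons_bullet, ih₁ h₁ hpc, ih₂ h₂ hpc,
      ih₃ h₃ (hLo _ _ hf hpc), List.append_nil]
  | tapp hb₁ _ ih₁ ih₂ =>
    cases h with | tapp h₁ hf hw =>
    simp only [visibleTrace_append, visibleTrace_cons_bullet, ih₁ h₁ hpc,
      ih₂ ((hb₁.hasType h₁).tlam_tsubst_single hw) (hLo _ _ hf hpc), List.append_nil]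
  | pair _ _ ih₁ ih₂ =>
    cases h with | pair h₁ h₂ =>
    rw [visibleTrace_append, ih₁ h₁ hpc, ih₂ h₂ hpc, List.append_nil]
  | proj _ ih =>
    cases h with | proj h =>
    rw [visibleTrace_append, ih h hpc]; rfl
  | inj _ ih => cases h with | inj h => exact ih h hpc
  | case hb₁ _ ih₁ ih₂ =>
    cases h with | case h _ h₁ h₂ =>
    simp only [visibleTrace_append, visibleTrace_cons_bullet, ih₁ h hpc,
      ih₂ ((hb₁.hasType h).inj_branch_inst hb₁.isValue h₁ h₂) hpc, List.append_nil]
  | ret _ ih =>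
    cases h with | unitM h hf =>
    simp [visibleTrace_append, visibleTrace_singleton, ih h hpc,
      Event.visible_val_vret_of_notMem (hLo _ _ hf hpc)]
  | bind hb₁ _ ih₁ ih₂ =>
    cases h with | bindM h _ h' =>
    have hbody := (hb₁.hasType h).vret_inst h'
    simp only [visibleTrace_append, visibleTrace_cons_bullet, ih₁ h hpc,
      ih₂ hbody (hLo _ _ (Label.flowsTo_join_left _ _) hpc), List.append_nil]
  | decl _ ih =>
    cases h with | decl h _ hf _ =>
    simp [visibleTrace_append, visibleTrace_singleton, ih h hpc,
      Event.visible_down_of_notMem (hLo _ _ hf hpc)]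
  | endorse _ ih =>
    cases h with | endorse h _ hf _ =>
    simp [visibleTrace_append, visibleTrace_singleton, ih h hpc,
      Event.visible_down_of_notMem (hLo _ _ hf hpc)]

/-- The common erasure of all values of a type that protects an invisible label. -/
def Ty.mark : Ty D → Tm D
  | unit => .unit
  | prod τ₁ τ₂ => .pair τ₁.mark τ₂.mark
  | τ => .bullet τ

theorem Ty.mark_declFree (τ : Ty D) : τ.mark.DeclFree := by
  induction τ with
  | prod _ _ ih₁ ih₂ => exact ⟨ih₁, ih₂⟩
  | _ => trivial

theorem Protects.erase_eq_mark (hLo : FlowClosed Lo) {h : Label D} {v : Tm D}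
    (hp : Protects h τ) (hh : h ∉ Lo) (hv : v.IsValue) (ht : HasType n Γ pc v τ) :
    v.erase Lo = τ.mark := by
  induction hp generalizing v with
  | unit =>
    cases hv <;> cases ht
    rfl
  | lbl hf =>
    cases hv <;> cases ht
    exact Tm.erase_vret_of_notMem (hLo _ _ hf hh) _ _
  | pair _ _ ih₁ ih₂ =>
    cases hv with
    | pair hv₁ hv₂ =>
      cases ht with | pair ht₁ ht₂ =>
      rw [Tm.erase, Ty.mark, ih₁ hv₁ ht₁, ih₂ hv₂ ht₂]
    | _ => cases ht

/-- Every declassification recorded in the trace has an invisible target. -/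
def NoVisibleDecl (Lo : Set (Label D)) (t : Trace D) : Prop :=
  ∀ l' l τ v, Event.down .conf l' l τ v ∈ t → l ∉ Lo

theorem noVisibleDecl_nil : NoVisibleDecl Lo ([] : Trace D) := by simp [NoVisibleDecl]

theorem NoVisibleDecl.append {s : Trace D} (hs : NoVisibleDecl Lo s) (ht : NoVisibleDecl Lo t) :
    NoVisibleDecl Lo (s ++ t) := fun l' l τ v hmem =>
  (List.mem_append.1 hmem).elim (hs l' l τ v) (ht l' l τ v)

theorem NoVisibleDecl.cons (ht : NoVisibleDecl Lo t) {c : Event D}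
    (hc : ∀ l' l τ v, c ≠ .down .conf l' l τ v) : NoVisibleDecl Lo (c :: t) := fun l' l τ v hmem =>
  ht l' l τ v ((List.mem_cons.1 hmem).resolve_left (hc l' l τ v).symm)

theorem NoVisibleDecl.cons_bullet (ht : NoVisibleDecl Lo t) : NoVisibleDecl Lo (.bullet :: t) :=
  ht.cons nofun

theorem noVisibleDecl_of_visibleTrace_eq_nil (ht : visibleTrace Lo t = []) :
    NoVisibleDecl Lo t := by
  intro l' l τ v hmem hl
  have := List.filterMap_eq_nil_iff.1 ht _ hmem
  simp [Event.visible_down_of_mem hl] at this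

theorem Tm.declFree_erase_vret {l : Label D} {v : Tm D} (h : l ∈ Lo → (v.erase Lo).DeclFree) :
    ((Tm.vret l τ v).erase Lo).DeclFree := by
  by_cases hl : l ∈ Lo
  · rw [Tm.erase_vret_of_mem hl]
    exact h hl
  · rw [Tm.erase_vret_of_notMem hl]
    trivial

theorem Tm.declFree_erase_inst {b v : Tm D} (hb : (b.erase Lo).DeclFree)
    (hv : (v.erase Lo).DeclFree) : ((b.inst v).erase Lo).DeclFree := by
  rw [Tm.erase_inst]
  exact hb.inst hv

theorem Tm.declFree_erase_tsubst {b : Tm D} (hb : (b.erase Lo).DeclFree) (θ : ℕ → Ty D) :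
    ((b.tsubst θ).erase Lo).DeclFree := by
  rw [Tm.erase_tsubst]
  exact hb.tsubst θ

/-- What an invisible value contributes when it is bound is confined, so it may contain `decl`. -/
theorem Eval.declFree_erase_bind (hLo : FlowClosed Lo) {l : Label D} {σ : Ty D} {b v : Tm D}
    (hb : Eval (b.inst v) u t) (h : HasType n Γ pc (b.inst v) τ) (hf : l.FlowsTo pc)
    (hp : Protects l τ) (hd : (b.erase Lo).DeclFree) (hdv : ((Tm.vret l σ v).erase Lo).DeclFree)
    (ih : ((b.inst v).erase Lo).DeclFree → (u.erase Lo).DeclFree ∧ NoVisibleDecl Lo t) :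
    (u.erase Lo).DeclFree ∧ NoVisibleDecl Lo t := by
  by_cases hl : l ∈ Lo
  · rw [Tm.erase_vret_of_mem hl] at hdv
    exact ih (Tm.declFree_erase_inst hd hdv)
  · rw [hp.erase_eq_mark hLo hl hb.isValue (hb.hasType h)]
    exact ⟨τ.mark_declFree,
      noVisibleDecl_of_visibleTrace_eq_nil (hb.visibleTrace_eq_nil hLo h (hLo _ _ hf hl))⟩

theorem Eval.declFree_erase (hLo : FlowClosed Lo)
    (hend : ∀ l' l : Label D, Downgradable .integ l' l → l ∈ Lo → l' ∈ Lo) (hb : Eval e u t)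
    (h : HasType n Γ pc e τ) (hd : (e.erase Lo).DeclFree) :
    (u.erase Lo).DeclFree ∧ NoVisibleDecl Lo t := by
  induction hb generalizing pc τ with
  | unit | lam | tlam | vret => exact ⟨hd, noVisibleDecl_nil⟩
  | app hb₁ hb₂ _ ih₁ ih₂ ih₃ =>
    cases h with | app h₁ h₂ _ =>
    obtain ⟨hd₁, ht₁⟩ := ih₁ h₁ hd.1
    obtain ⟨hd₂, ht₂⟩ := ih₂ h₂ hd.2
    have hbody := (hb₁.hasType h₁).lam_inst hb₂.isValue (hb₂.hasType h₂)
    exact (ih₃ hbody (Tm.declFree_erase_inst hd₁ hd₂)).imp_right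
      fun ht₃ => ht₁.append (ht₂.append ht₃.cons_bullet)
  | @tapp _ b _ _ _ _ _ hb₁ _ ih₁ ih₂ =>
    cases h with | tapp h₁ _ hw =>
    obtain ⟨hd₁, ht₁⟩ := ih₁ h₁ hd
    have hbody := (hb₁.hasType h₁).tlam_tsubst_single hw
    exact (ih₂ hbody (Tm.declFree_erase_tsubst (b := b) hd₁ _)).imp_right
      fun ht₂ => ht₁.append ht₂.cons_bullet
  | pair _ _ ih₁ ih₂ =>
    cases h with | pair h₁ h₂ =>
    obtain ⟨hd₁, ht₁⟩ := ih₁ h₁ hd.1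
    exact (ih₂ h₂ hd.2).imp (⟨hd₁, ·⟩) ht₁.append
  | @proj i _ _ _ _ _ ih =>
    cases h with | proj h =>
    obtain ⟨⟨hd₁, hd₂⟩, ht⟩ := ih h hd
    exact ⟨by cases i <;> assumption, ht.append noVisibleDecl_nil.cons_bullet⟩
  | inj _ ih => cases h with | inj h => exact ih h hd
  | @case i _ _ _ _ _ _ _ _ _ hb₁ _ ih₁ ih₂ =>
    cases h with | case h _ h₁ h₂ =>
    obtain ⟨hd₁, ht₁⟩ := ih₁ h hd.1
    have hbranch := (hb₁.hasType h).inj_branch_inst hb₁.isValue h₁ h₂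
    refine (ih₂ hbranch (Tm.declFree_erase_inst ?_ hd₁)).imp_right
      fun ht₂ => ht₁.append ht₂.cons_bullet
    cases i
    exacts [hd.2.1, hd.2.2]
  | ret _ ih =>
    cases h with | unitM h _ =>
    exact (ih h hd).imp (fun hd => Tm.declFree_erase_vret fun _ => hd)
      fun ht => ht.append (noVisibleDecl_nil.cons nofun)
  | bind hb₁ hb₂ ih₁ ih₂ =>
    cases h with | bindM h hp h' =>
    cases hb₁.hasType h with | vunitM hv k =>
    have hbody := h'.inst hv k
    obtain ⟨hd₁, ht₁⟩ := ih₁ h hd.1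
    exact (hb₂.declFree_erase_bind hLo hbody (Label.flowsTo_join_right _ _) hp hd.2 hd₁
      (ih₂ hbody)).imp_right fun ht₂ => ht₁.append ht₂.cons_bullet
  | decl => exact hd.elim
  | endorse hb ih =>
    cases h with | endorse h hc _ hi =>
    cases hb.hasType h with | vunitM _ _ =>
    refine (ih h hd).imp (fun hd => Tm.declFree_erase_vret fun hl => ?_)
      fun ht => ht.append (noVisibleDecl_nil.cons nofun)
    rwa [Tm.erase_vret_of_mem (hend _ _ ⟨hc, _, hi⟩ hl)] at hd

end Eval

/-! ## Simulation of low-equivalent expressions -/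

section Simulation

variable {Lo : Set (Label D)} {n : ℕ} {Γ : List (Ty D)} {pc : Label D} {e e' u u' v v' : Tm D}
  {τ : Ty D} {s t : Trace D}

/-- Two traces look the same up to a downgrade that turns an invisible value into a visible one,
and this reveals a difference between the two values. -/
def Diverges (Lo : Set (Label D)) (s t : Trace D) : Prop :=
  ∃ (s₁ s₂ t₁ t₂ : Trace D) (π : Aspect) (l' l : Label D) (τ : Ty D) (v v' : Tm D),
    s = s₁ ++ .down π l' l τ v :: s₂ ∧ t = t₁ ++ .down π l' l τ v' :: t₂ ∧
    visibleTrace Lo s₁ = visibleTrace Lo t₁ ∧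
    Downgradable π l' l ∧ l' ∉ Lo ∧ l ∈ Lo ∧ v.erase Lo ≠ v'.erase Lo

theorem Diverges.append (h : Diverges Lo s t) (s' t' : Trace D) :
    Diverges Lo (s ++ s') (t ++ t') := by
  obtain ⟨s₁, s₂, t₁, t₂, π, l', l, τ, v, v', rfl, rfl, h⟩ := h
  exact ⟨s₁, s₂ ++ s', t₁, t₂ ++ t', π, l', l, τ, v, v', by simp, by simp, h⟩

theorem Diverges.prepend {s' t' : Trace D} (h : Diverges Lo s t)
    (hs : visibleTrace Lo s' = visibleTrace Lo t') : Diverges Lo (s' ++ s) (t' ++ t) := by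
  obtain ⟨s₁, s₂, t₁, t₂, π, l', l, τ, v, v', rfl, rfl, ht, h⟩ := h
  exact ⟨s' ++ s₁, s₂, t' ++ t₁, t₂, π, l', l, τ, v, v', by simp, by simp,
    by rw [visibleTrace_append, visibleTrace_append, hs, ht], h⟩

/-- Two evaluations, with results `u`, `u'` and traces `s`, `t`, look the same unless their traces
diverge. -/
def Agree (Lo : Set (Label D)) (u : Tm D) (s : Trace D) (u' : Tm D) (t : Trace D) : Prop :=
  (u.erase Lo = u'.erase Lo ∧ visibleTrace Lo s = visibleTrace Lo t) ∨ Diverges Lo s t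

theorem Agree.bind {r r' : Tm D} {s₂ t₂ : Trace D} (h : Agree Lo u s u' t)
    (h₂ : u.erase Lo = u'.erase Lo → Agree Lo r s₂ r' t₂) :
    Agree Lo r (s ++ s₂) r' (t ++ t₂) := by
  rcases h with ⟨hu, ht⟩ | h
  · rcases h₂ hu with ⟨hr, ht₂⟩ | h₂
    · exact .inl ⟨hr, by rw [visibleTrace_append, visibleTrace_append, ht, ht₂]⟩
    · exact .inr (h₂.prepend ht)
  · exact .inr (h.append _ _)

theorem Agree.map {r r' : Tm D} (h : Agree Lo u s u' t)
    (hr : u.erase Lo = u'.erase Lo → r.erase Lo = r'.erase Lo) : Agree Lo r s r' t :=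
  h.imp_left fun ⟨hu, ht⟩ => ⟨hr hu, ht⟩

theorem Agree.cons_bullet (h : Agree Lo u s u' t) :
    Agree Lo u (.bullet :: s) u' (.bullet :: t) :=
  Agree.bind (u := .unit) (u' := .unit) (s := [.bullet]) (t := [.bullet]) (.inl ⟨rfl, rfl⟩)
    fun _ => h

theorem Agree.down {π : Aspect} {l' l : Label D} (hd : Downgradable π l' l)
    (hv : (Tm.vret l' τ v).erase Lo = (Tm.vret l' τ v').erase Lo) :
    Agree Lo (.vret l τ v) [.down π l' l τ v] (.vret l τ v') [.down π l' l τ v'] := by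
  by_cases hl : l ∈ Lo
  · by_cases heq : v.erase Lo = v'.erase Lo
    · left
      simp only [visibleTrace_singleton, Event.visible_down_of_mem hl, Tm.erase_vret_of_mem hl, heq,
        and_self]
    · have hl' : l' ∉ Lo := fun hl' => heq ((Tm.erase_vret_eq_iff.1 hv).2.2 hl')
      exact .inr ⟨[], [], [], [], π, l', l, τ, v, v', rfl, rfl, rfl, hd, hl', hl, heq⟩
  · left
    simp only [visibleTrace_singleton, Event.visible_down_of_notMem hl,
      Tm.erase_vret_of_notMem hl, and_self]

theorem Agree.vret {l : Label D} (h : v.erase Lo = v'.erase Lo) :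
    Agree Lo (.vret l τ v) [.val (.vret l τ v)] (.vret l τ v') [.val (.vret l τ v')] := by
  have hv : (Tm.vret l τ v).erase Lo = (Tm.vret l τ v').erase Lo :=
    Tm.erase_vret_eq_iff.2 ⟨rfl, rfl, fun _ => h⟩
  refine .inl ⟨hv, ?_⟩
  rw [visibleTrace_singleton, visibleTrace_singleton, Event.visible_val_congr hv]

theorem Eval.agree_of_protects (hLo : FlowClosed Lo) {l pc' : Label D} (hl : l ∉ Lo)
    (hp : Protects l τ) (hb : Eval e u s) (h : HasType n Γ pc e τ) (hf : l.FlowsTo pc)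
    (hb' : Eval e' u' t) (h' : HasType n Γ pc' e' τ) (hf' : l.FlowsTo pc') :
    Agree Lo u s u' t := by
  left
  rw [hp.erase_eq_mark hLo hl hb.isValue (hb.hasType h),
    hp.erase_eq_mark hLo hl hb'.isValue (hb'.hasType h'),
    hb.visibleTrace_eq_nil hLo h (hLo _ _ hf hl), hb'.visibleTrace_eq_nil hLo h' (hLo _ _ hf' hl)]
  exact ⟨rfl, rfl⟩

/-- The evaluation of `e` to `u` with trace `s` agrees with every evaluation of a well-typed
expression that looks like `e`. -/
def EvalsAgree (Lo : Set (Label D)) (n : ℕ) (Γ : List (Ty D)) (e u : Tm D) (s : Trace D) : Prop :=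
  ∀ ⦃pc : Label D⦄ ⦃e' : Tm D⦄ ⦃τ : Ty D⦄ ⦃u' : Tm D⦄ ⦃t : Trace D⦄, HasType n Γ pc e' τ →
    e'.erase Lo = e.erase Lo → Eval e' u' t → Agree Lo u s u' t

theorem Tm.IsValue.of_erase_eq (hv : v.IsValue) (h : HasType n Γ pc e τ)
    (he : e.erase Lo = v.erase Lo) : e.IsValue := by
  induction hv generalizing e τ with
  | unit =>
    obtain rfl := Tm.erase_eq_unit_iff.1 he
    exact .unit
  | inj _ ih =>
    obtain ⟨e₁, rfl, he₁⟩ := Tm.erase_eq_inj_iff.1 he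
    cases h with | inj h => exact .inj (ih h he₁)
  | pair _ _ ih₁ ih₂ =>
    obtain ⟨e₁, e₂, rfl, he₁, he₂⟩ := Tm.erase_eq_pair_iff.1 he
    cases h with | pair h₁ h₂ => exact .pair (ih₁ h₁ he₁) (ih₂ h₂ he₂)
  | vret =>
    rcases Tm.erase_eq_erase_vret_iff.1 he with ⟨v', rfl, -⟩ | ⟨-, rfl⟩
    · cases h with | vunitM hv _ => exact .vret hv
    · cases h
  | lam =>
    obtain ⟨e₁, rfl, -⟩ := Tm.erase_eq_lam_iff.1 he
    exact .lam
  | tlam =>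
    obtain ⟨e₁, rfl, -⟩ := Tm.erase_eq_tlam_iff.1 he
    exact .tlam

theorem Tm.IsValue.evalsAgree (hv : v.IsValue) : EvalsAgree Lo n Γ v v [] := by
  intro pc e' τ u' t h he hb
  obtain ⟨rfl, rfl⟩ := (hv.of_erase_eq h he).eq_of_eval hb
  exact .inl ⟨he.symm, rfl⟩

namespace EvalsAgree

variable {e₁ e₂ b v₁ v₂ : Tm D} {τ₁ τ₂ : Ty D} {l l' : Label D} {i : Bool} {s₁ s₂ s₃ : Trace D}

theorem app (h₁ : EvalsAgree Lo n Γ e₁ (.lam τ pc b) s₁) (h₂ : EvalsAgree Lo n Γ e₂ v s₂)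
    (h₃ : EvalsAgree Lo n Γ (b.inst v) u s₃) :
    EvalsAgree Lo n Γ (.app e₁ e₂) u (s₁ ++ (s₂ ++ .bullet :: s₃)) := by
  intro pc' e' τ' u' t h he hb
  obtain ⟨e₁', e₂', rfl, he₁, he₂⟩ := Tm.erase_eq_app_iff.1 he
  cases h with | app k₁ k₂ _ =>
  cases hb with | app hb₁ hb₂ hb₃ =>
  have hbody := (hb₁.hasType k₁).lam_inst hb₂.isValue (hb₂.hasType k₂)
  refine (h₁ k₁ he₁ hb₁).bind fun hf => (h₂ k₂ he₂ hb₂).bind fun hv =>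
    .cons_bullet (h₃ hbody ?_ hb₃)
  rw [Tm.erase_inst, Tm.erase_inst, (Tm.lam.inj hf).2.2, hv]

theorem tapp (h₁ : EvalsAgree Lo n Γ e (.tlam pc b) s₁)
    (h₂ : EvalsAgree Lo n Γ (b.tsubst (Ty.single τ)) u s₂) :
    EvalsAgree Lo n Γ (.tapp e τ) u (s₁ ++ .bullet :: s₂) := by
  intro pc' e' τ' u' t h he hb
  obtain ⟨e₁', rfl, he₁⟩ := Tm.erase_eq_tapp_iff.1 he
  cases h with | tapp k₁ _ hw =>
  cases hb with | tapp hb₁ hb₂ =>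
  have hbody := (hb₁.hasType k₁).tlam_tsubst_single hw
  refine (h₁ k₁ he₁ hb₁).bind fun hf => .cons_bullet (h₂ hbody ?_ hb₂)
  rw [Tm.erase_tsubst, Tm.erase_tsubst, (Tm.tlam.inj hf).2]

theorem pair (h₁ : EvalsAgree Lo n Γ e₁ v₁ s₁) (h₂ : EvalsAgree Lo n Γ e₂ v₂ s₂) :
    EvalsAgree Lo n Γ (.pair e₁ e₂) (.pair v₁ v₂) (s₁ ++ s₂) := by
  intro pc' e' τ' u' t h he hb
  obtain ⟨e₁', e₂', rfl, he₁, he₂⟩ := Tm.erase_eq_pair_iff.1 he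
  cases h with | pair k₁ k₂ =>
  cases hb with | pair hb₁ hb₂ =>
  exact (h₁ k₁ he₁ hb₁).bind fun hv₁ => (h₂ k₂ he₂ hb₂).map fun hv₂ => by
    rw [Tm.erase, Tm.erase, hv₁, hv₂]

theorem proj (h₁ : EvalsAgree Lo n Γ e (.pair v₁ v₂) s₁) :
    EvalsAgree Lo n Γ (.proj i e) (bif i then v₂ else v₁) (s₁ ++ [.bullet]) := by
  intro pc' e' τ' u' t h he hb
  obtain ⟨e₁', rfl, he₁⟩ := Tm.erase_eq_proj_iff.1 he
  cases h with | proj k₁ =>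
  cases hb with | proj hb₁ =>
  refine (h₁ k₁ he₁ hb₁).bind fun hv => .inl ⟨?_, rfl⟩
  cases i
  exacts [(Tm.pair.inj hv).1, (Tm.pair.inj hv).2]

theorem inj (h₁ : EvalsAgree Lo n Γ e v s₁) :
    EvalsAgree Lo n Γ (.inj i τ₁ τ₂ e) (.inj i τ₁ τ₂ v) s₁ := by
  intro pc' e' τ' u' t h he hb
  obtain ⟨e₁', rfl, he₁⟩ := Tm.erase_eq_inj_iff.1 he
  cases h with | inj k₁ =>
  cases hb with | inj hb₁ =>
  exact (h₁ k₁ he₁ hb₁).map fun hv => by rw [Tm.erase, Tm.erase, hv]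

theorem case (h₁ : EvalsAgree Lo n Γ e (.inj i τ₁ τ₂ v) s₁)
    (h₂ : EvalsAgree Lo n Γ ((bif i then e₂ else e₁).inst v) u s₂) :
    EvalsAgree Lo n Γ (.case e e₁ e₂) u (s₁ ++ .bullet :: s₂) := by
  intro pc' e' τ' u' t h he hb
  obtain ⟨e', e₁', e₂', rfl, he₀, he₁, he₂⟩ := Tm.erase_eq_case_iff.1 he
  cases h with | case k _ k₁ k₂ =>
  cases hb with | case hb₁ hb₂ =>
  have hbranch := (hb₁.hasType k).inj_branch_inst hb₁.isValue k₁ k₂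
  refine (h₁ k he₀ hb₁).bind fun hv => .cons_bullet (h₂ hbranch ?_ hb₂)
  obtain ⟨rfl, -, -, hv⟩ := Tm.inj.inj hv
  rw [Tm.erase_inst, Tm.erase_inst, hv]
  cases i
  exacts [he₁ ▸ rfl, he₂ ▸ rfl]

theorem ret (h₁ : EvalsAgree Lo n Γ e v s₁) :
    EvalsAgree Lo n Γ (.ret l τ e) (.vret l τ v) (s₁ ++ [.val (.vret l τ v)]) := by
  intro pc' e' τ' u' t h he hb
  obtain ⟨e₁', rfl, he₁⟩ := Tm.erase_eq_ret_iff.1 he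
  cases h with | unitM k₁ _ =>
  cases hb with | ret hb₁ =>
  exact (h₁ k₁ he₁ hb₁).bind fun hv => .vret hv

/-- Where the bound value is invisible, the two bodies need not look alike. -/
theorem bind (hLo : FlowClosed Lo) {e b : Tm D} (h : HasType n Γ pc (.bind e b) τ)
    (hb₁ : Eval e (.vret l τ₁ v) s₁) (hb₂ : Eval (b.inst v) u s₂)
    (h₁ : EvalsAgree Lo n Γ e (.vret l τ₁ v) s₁) (h₂ : EvalsAgree Lo n Γ (b.inst v) u s₂) :
    EvalsAgree Lo n Γ (.bind e b) u (s₁ ++ .bullet :: s₂) := by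
  intro pc' e' τ' u' t h' he hb'
  obtain rfl := h.unique_of_erase_eq h' he.symm
  obtain ⟨e₁', b', rfl, he₁, heb⟩ := Tm.erase_eq_bind_iff.1 he
  cases h with | bindM k₁ hp kb =>
  cases h' with | bindM k₁' hp' kb' =>
  cases hb' with | bind hb₁' hb₂' =>
  cases hb₁.hasType k₁ with | vunitM hv kv =>
  cases hb₁'.hasType k₁' with | vunitM hv' kv' =>
  refine (h₁ k₁' he₁ hb₁').bind fun hu => .cons_bullet ?_
  obtain ⟨rfl, rfl, hvv'⟩ := Tm.erase_vret_eq_iff.1 hu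
  by_cases hl : l ∈ Lo
  · refine h₂ (kb'.inst hv' kv') ?_ hb₂'
    rw [Tm.erase_inst, Tm.erase_inst, heb, hvv' hl]
  · exact hb₂.agree_of_protects hLo hl hp (kb.inst hv kv) (Label.flowsTo_join_right _ _) hb₂'
      (kb'.inst hv' kv') (Label.flowsTo_join_right _ _)

theorem decl (h₁ : EvalsAgree Lo n Γ e (.vret l' τ v) s₁) :
    EvalsAgree Lo n Γ (.decl e l) (.vret l τ v) (s₁ ++ [.down .conf l' l τ v]) := by
  intro pc' e' τ' u' t h he hb
  obtain ⟨e₁', rfl, he₁⟩ := Tm.erase_eq_decl_iff.1 he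
  cases h with | decl k₁ hc _ hf =>
  cases hb with | decl hb₁ =>
  cases hb₁.hasType k₁ with | vunitM _ _ =>
  refine (h₁ k₁ he₁ hb₁).bind fun hu => ?_
  obtain ⟨rfl, rfl, -⟩ := Tm.erase_vret_eq_iff.1 hu
  exact .down ⟨hc, _, hf⟩ hu

theorem endorse (h₁ : EvalsAgree Lo n Γ e (.vret l' τ v) s₁) :
    EvalsAgree Lo n Γ (.endorse e l) (.vret l τ v) (s₁ ++ [.down .integ l' l τ v]) := by
  intro pc' e' τ' u' t h he hb
  obtain ⟨e₁', rfl, he₁⟩ := Tm.erase_eq_endorse_iff.1 he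
  cases h with | endorse k₁ hc _ hf =>
  cases hb with | endorse hb₁ =>
  cases hb₁.hasType k₁ with | vunitM _ _ =>
  refine (h₁ k₁ he₁ hb₁).bind fun hu => ?_
  obtain ⟨rfl, rfl, -⟩ := Tm.erase_vret_eq_iff.1 hu
  exact .down ⟨hc, _, hf⟩ hu

end EvalsAgree

theorem Eval.evalsAgree (hLo : FlowClosed Lo) (hb : Eval e u s) (h : HasType n Γ pc e τ) :
    EvalsAgree Lo n Γ e u s := by
  induction hb generalizing pc τ with
  | unit => exact Tm.IsValue.unit.evalsAgree
  | lam => exact Tm.IsValue.lam.evalsAgree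
  | tlam => exact Tm.IsValue.tlam.evalsAgree
  | vret hv => exact (Tm.IsValue.vret hv).evalsAgree
  | app hb₁ hb₂ _ ih₁ ih₂ ih₃ =>
    cases h with | app h₁ h₂ _ =>
    have hbody := (hb₁.hasType h₁).lam_inst hb₂.isValue (hb₂.hasType h₂)
    exact .app (ih₁ h₁) (ih₂ h₂) (ih₃ hbody)
  | tapp hb₁ _ ih₁ ih₂ =>
    cases h with | tapp h₁ _ hw =>
    exact .tapp (ih₁ h₁) (ih₂ ((hb₁.hasType h₁).tlam_tsubst_single hw))
  | pair _ _ ih₁ ih₂ => cases h with | pair h₁ h₂ => exact .pair (ih₁ h₁) (ih₂ h₂)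
  | proj _ ih => cases h with | proj h => exact .proj (ih h)
  | inj _ ih => cases h with | inj h => exact .inj (ih h)
  | case hb₁ _ ih₁ ih₂ =>
    cases h with | case h _ h₁ h₂ =>
    exact .case (ih₁ h) (ih₂ ((hb₁.hasType h).inj_branch_inst hb₁.isValue h₁ h₂))
  | ret _ ih => cases h with | unitM h _ => exact .ret (ih h)
  | bind hb₁ hb₂ ih₁ ih₂ =>
    have hbind := h
    cases h with | bindM h _ h' =>
    exact .bind hLo hbind hb₁ hb₂ (ih₁ h) (ih₂ ((hb₁.hasType h).vret_inst h'))
  | decl _ ih => cases h with | decl h _ _ _ => exact .decl (ih h)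
  | endorse _ ih => cases h with | endorse h _ _ _ => exact .endorse (ih h)

end Simulation

/-! ## Two runs of a program -/

section Runs

variable {Lo A H : Set (Label D)} {n : ℕ} {Γ : List (Ty D)} {pc : Label D} {e v v' w w' : Tm D}
  {τx τy τ : Ty D} {t t' : Trace D}

theorem HighType.erase_eq_mark (hH : FlowClosed Hᶜ) (hτ : HighType H τ)
    (hv : IsInput n Γ pc τ v) : v.erase Hᶜ = τ.mark :=
  let ⟨_, hh, hp⟩ := hτ
  hp.erase_eq_mark hH (Set.notMem_compl_iff.2 hh) hv.1 hv.2

theorem Runs.visibleTrace_eq_or_diverges (hLo : FlowClosed Lo)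
    (he : HasType n (τy :: τx :: Γ) pc e τ) (hv : IsInput n Γ pc τx v) (hv' : IsInput n Γ pc τx v')
    (hw : IsInput n Γ pc τy w) (hw' : IsInput n Γ pc τy w') (hr : Runs e v w t)
    (hr' : Runs e v' w' t') (hvv' : v.erase Lo = v'.erase Lo) (hww' : w.erase Lo = w'.erase Lo) :
    visibleTrace Lo t = visibleTrace Lo t' ∨ Diverges Lo t t' := by
  obtain ⟨u, s, rfl, hb⟩ := hr.eval
  obtain ⟨u', s', rfl, hb'⟩ := hr'.eval
  have inputs_agree : visibleTrace Lo [.val v, .val w] = visibleTrace Lo [.val v', .val w'] := by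
    simp only [visibleTrace_cons, Event.visible_val_congr hvv', Event.visible_val_congr hww']
  have agree : Agree Lo u s u' s' := by
    refine hb.evalsAgree hLo (he.inst₂ hv hw) (he.inst₂ hv' hw') ?_ hb'
    rw [Tm.erase_inst₂, Tm.erase_inst₂, hvv', hww']
  rcases agree with ⟨-, ht⟩ | hdiv
  · refine .inl ((visibleTrace_append Lo [.val v, .val w] s).trans ?_)
    rw [inputs_agree, ht, ← visibleTrace_append]
    rfl
  · exact .inr (hdiv.prepend inputs_agree)

theorem Runs.noVisibleDecl (hA : IsAttacker A) (he : HasType n (τy :: τx :: Γ) pc e τ)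
    (hd : e.DeclFree) (hx : HighType (secret A) τx) (hv : IsInput n Γ pc τx v)
    (hw : IsInput n Γ pc τy w) (hwd : w.DeclFree) (hr : Runs e v w t) :
    NoVisibleDecl (secret A)ᶜ t := by
  obtain ⟨u, s, rfl, hb⟩ := hr.eval
  have hLo := hA.flowClosed_public
  have erase_declFree : ((e.inst₂ v w).erase (secret A)ᶜ).DeclFree := by
    rw [Tm.erase_inst₂, hx.erase_eq_mark hLo hv]
    exact (hd.erase _).inst₂ τx.mark_declFree (hwd.erase _)
  have hs := (hb.declFree_erase hLo (fun _ _ => mem_public_of_downgradable_integ)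
    (he.inst₂ hv hw) erase_declFree).2
  exact (hs.cons (by nofun)).cons (by nofun)

theorem Runs.public_agree (hA : IsAttacker A) (he : HasType n (τy :: τx :: Γ) pc e τ)
    (hd : e.DeclFree) (hx : HighType (secret A) τx) (hv : IsInput n Γ pc τx v)
    (hv' : IsInput n Γ pc τx v') (hw : IsInput n Γ pc τy w) (hwd : w.DeclFree)
    (hr : Runs e v w t) (hr' : Runs e v' w t') :
    visibleTrace (secret A)ᶜ t = visibleTrace (secret A)ᶜ t' := by
  have hLo := hA.flowClosed_public
  have hvv' := (hx.erase_eq_mark hLo hv).trans (hx.erase_eq_mark hLo hv').symm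
  refine (hr.visibleTrace_eq_or_diverges hLo he hv hv' hw hw hr' hvv' rfl).resolve_right ?_
  rintro ⟨s₁, s₂, t₁, t₂, π, l', l, σ, x, x', hs, -, -, hdown, hl', hl, -⟩
  cases π with
  | conf => exact hr.noVisibleDecl hA he hd hx hv hw hwd l' l σ x (by simp [hs]) hl
  | integ => exact hl' (mem_public_of_downgradable_integ hdown hl)

theorem Runs.trusted_agree_or_exists_endorse (hA : IsAttacker A)
    (he : HasType n (τy :: τx :: Γ) pc e τ) (hy : HighType (untrusted A) τy)
    (hv : IsInput n Γ pc τx v) (hw : IsInput n Γ pc τy w) (hw' : IsInput n Γ pc τy w')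
    (hr : Runs e v w t) (hr' : Runs e v w' t') :
    visibleTrace (trusted A) t = visibleTrace (trusted A) t' ∨
      ∃ k k', VisibleAt (lowSet A) t k ∧ VisibleAt (lowSet A) t' k' ∧
        visibleTrace (trusted A) (t.take k) = visibleTrace (trusted A) (t'.take k') ∧
        visibleTrace (trusted A) (t.take (k + 1)) ≠
          visibleTrace (trusted A) (t'.take (k' + 1)) := by
  have hLo := hA.flowClosed_trusted
  have hww' := (hy.erase_eq_mark hLo hw).trans (hy.erase_eq_mark hLo hw').symm
  refine (hr.visibleTrace_eq_or_diverges hLo he hv hv hw hw' hr' rfl hww').imp_right ?_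
  rintro ⟨s₁, s₂, t₁, t₂, π, l', l, σ, x, x', rfl, rfl, hpast, hdown, hl', hl, hne⟩
  have hlow : l ∈ lowSet A := by
    cases π with
    | conf => exact absurd (mem_trusted_of_downgradable_conf hdown hl) hl'
    | integ => exact hA.mem_lowSet_of_downgradable_integ hdown hl' hl
  refine ⟨s₁.length, t₁.length, visibleAt_append_cons ?_ _ _, visibleAt_append_cons ?_ _ _, ?_, ?_⟩
  · simp [Event.visible_down_of_mem hlow]
  · simp [Event.visible_down_of_mem hlow]
  · rw [List.take_left, List.take_left, hpast]
  · rw [visibleTrace_take_succ (c := .down π l' l σ x) _ (by simp),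
      visibleTrace_take_succ (c := .down π l' l σ x') _ (by simp)]
    simp [hpast, Event.visible_down_of_mem hl, hne]

theorem irrelevantSecret_of_visibleAt {v w : Fin 2 → Tm D} {t : Fin 2 → Fin 2 → Trace D}
    {k : Fin 2 → Fin 2 → ℕ} {r s : Trace D} (hv : ∀ i, IsInput n Γ pc τx (v i))
    (hw : ∀ j, IsInput n Γ pc τy (w j)) (hr : ∀ i j, Runs e (v i) (w j) (t i j))
    (hlow : ∀ i j, visibleTrace (lowSet A) (t i j) = r)
    (hk : ∀ i j, VisibleAt (lowSet A) (t i j) (k i j))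
    (hpast : ∀ i j, visibleTrace (lowSet A) ((t i j).take (k i j)) = s)
    (h₀ : visibleTrace (trusted A) (t 0 0) = visibleTrace (trusted A) (t 0 1))
    (h₁ : visibleTrace (trusted A) ((t 1 0).take (k 1 0 + 1)) ≠
      visibleTrace (trusted A) ((t 1 1).take (k 1 1 + 1))) :
    IrrelevantSecret A n Γ pc τx τy e (v 0) := by
  refine ⟨hv 0, v, w, t, k, rfl, hv 1, hw, hr, ?_, ?_, ?_, ?_⟩
  · intro i j
    obtain ⟨c, hc, hvis⟩ := hk i j
    exact ⟨c, hc, fun h => hvis (eventEquiv_iff_visible_eq.1 h)⟩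
  · intro i j i' j'
    rw [traceEquiv_iff_visibleTrace_eq]
    exact (hk i j).visibleTrace_take_succ_eq subset_rfl (hk i' j')
      ((hlow i j).trans (hlow i' j').symm) ((hpast i j).trans (hpast i' j').symm)
  · rw [traceEquiv_iff_visibleTrace_eq]
    exact (hk 0 0).visibleTrace_take_succ_eq Set.inter_subset_left (hk 0 1) h₀
      ((hpast 0 0).trans (hpast 0 1).symm)
  · rwa [traceEquiv_iff_visibleTrace_eq]

end Runs

end NMIFC

open NMIFC in
theorem mainTheorem3 {N : Type*} (D : NMIFC.Delegation N)
    (n : ℕ) (Γ : List (NMIFC.Ty D)) (pc : NMIFC.Label D) (τx τy τ : NMIFC.Ty D)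
    (e : NMIFC.Tm D) (he : NMIFC.HasType n (τy :: τx :: Γ) pc e τ) (hd : e.DeclFree) :
    NMIFC.TransparentlyEndorses n Γ pc τx τy e := by
  intro A hA hx hy v w t hv hw hr ⟨hrel, h₀⟩
  rw [traceEquiv_iff_visibleTrace_eq] at h₀ ⊢
  rcases Runs.trusted_agree_or_exists_endorse hA he hy (hv 1) (hw 0).1 (hw 1).1 (hr 1 0) (hr 1 1)
    with h₁ | ⟨k₀, k₁, hk₀, hk₁, hpast, hne⟩
  · exact h₁
  have rows_agree : ∀ j, visibleTrace (lowSet A) (t 1 j) = visibleTrace (lowSet A) (t 0 j) :=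
    fun j => visibleTrace_eq_of_subset Set.inter_subset_right
      (Runs.public_agree hA he hd hx (hv 1) (hv 0) (hw j).1 (hw j).2 (hr 1 j) (hr 0 j))
  have columns_agree := visibleTrace_eq_of_subset (Lo' := lowSet A) Set.inter_subset_left h₀
  have pasts_agree := visibleTrace_eq_of_subset (Lo' := lowSet A) Set.inter_subset_left hpast
  obtain ⟨m₀, hm₀, hp₀⟩ := hk₀.exists_of_visibleTrace_eq (rows_agree 0)
  obtain ⟨m₁, hm₁, hp₁⟩ := hk₁.exists_of_visibleTrace_eq (rows_agree 1)
  refine absurd (irrelevantSecret_of_visibleAt (k := ![![m₀, m₁], ![k₀, k₁]])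
    (r := visibleTrace (lowSet A) (t 0 0))
    (s := visibleTrace (lowSet A) ((t 1 0).take k₀)) hv (fun j => (hw j).1) hr ?_ ?_ ?_ h₀ hne) hrel
  · simp [Fin.forall_fin_two, rows_agree, columns_agree]
  · simp [Fin.forall_fin_two, hm₀, hm₁, hk₀, hk₁]
  · simp [Fin.forall_fin_two, hp₀, hp₁, pasts_agree]
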